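/- Let $\mathbf H$ be a complex Hilbert space and let $A:\mathfrak D(A)\subseteq\mathbf H\to\mathbf H$ be a self-adjoint, strictly positive (possibly unbounded) operator, i.e. $\langle Ax,x\rangle\ge c\|x\|^2$ on $\mathfrak D(A)$ for some $c>0$. For $r\ge 0$ put $\mathbf H^r=\mathfrak D(A^{r/2})$, with $\|u\|_r=\|A^{r/2}u\|$. Let $\omega>0$, and let $\mathbf H^1$ carry the equivalent norm $\|z\|_{\mathbf H^1}=(\|z\|^2+\omega\|A^{1/2}z\|^2)^{1/2}$, for which the operator $I+\omega A:\mathbf H^1\to\mathbf H^{-1}=(\mathbf H^1)'$, $\langle(I+\omega A)z_1,z_2\rangle=\langle z_1,z_2\rangle+\omega\langle A^{1/2}z_1,A^{1/2}z_2\rangle$, is an isometric isomorphism. On the Hilbert space $\mathcal H_\omega=\mathbf H^2\times\mathbf H^1\times\mathbf H$ with norm $\|(u,v,\theta)\|^2=\|u\|_2^2+\|v\|_{\mathbf H^1}^2+\|\theta\|^2$ consider, for $\sigma\in\mathbb R$, the operator $$\mathbb A_\omega(u,v,\theta)=\bigl(v,\ (I+\omega A)^{-1}(-A^2u+A^\sigma\theta),\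 -A\theta-A^\sigma v\bigr)$$ with domain $$\mathfrak D(\mathbb A_\omega)=\{(u,v,\theta)\in\mathcal H_\omega:\ v\in\mathbf H^2,\ -u+A^{\sigma-2}\theta\in\mathbf H^3,\ -\theta-A^{\sigma-1}v\in\mathbf H^2\},$$ where $-A^2u+A^\sigma\theta$ means $A^2(-u+A^{\sigma-2}\theta)\in\mathbf H^{-1}$ and $-A\theta-A^\sigma v$ means $A(-\theta-A^{\sigma-1}v)\in\mathbf H$. If $\frac54\le\sigma\le\frac32$, then $\mathbb A_\omega$ is the infinitesimal generator of a strongly continuous semigroup of contractions $S_\omega(t)=e^{t\mathbb A_\omega}$ on $\mathcal H_\omega$, and this semigroup is analytic: for some $\varphi\in(0,\frac\pi2]$ it extends to a family of bounded operators $S_\omega(z)$, $z\in\Sigma_\varphi\cup\{0\}$, $\Sigma_\varphi=\{z\in\mathbb C\setminus\{0\}:|\arg z|<\varphi\}$, that is holomorphic on $\Sigma_\varphi$ in operator norm, satisfies $S_\omega(z+w)=S_\omega(z)S_\omega(w)$ for $z,w\in\Sigma_\varphi$, and satisfies $S_\omega(z)x\to x$ as $z\to0$ in $\Sigma_\varphi$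 for every $x\in\mathcal H_\omega$. -/

import Mathlib

open Filter Topology
open scoped NNReal

noncomputable section

/-- A strictly positive (positive definite) self-adjoint, possibly unbounded, operator on a complex
Hilbert space: `⟪A x, x⟫ ≥ c ‖x‖ ^ 2` on the domain, for some `c > 0`. (Self-adjointness in the
sense of partially defined operators forces the domain to be dense.) -/
structure StrictlyPositiveOperator (H : Type*) [NormedAddCommGroup H] [InnerProductSpace ℂ H]
    [CompleteSpace H] where
  /-- the operator together with its domain -/
  op : H →ₗ.[ℂ] H
  selfAdjoint : IsSelfAdjoint op
  coercive : ∃ c : ℝ, 0 < c ∧ ∀ x : op.domain, c * ‖(x : H)‖ ^ 2 ≤ (inner ℂ (op x) (x : H)).re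

namespace StrictlyPositiveOperator

variable {H : Type*} [NormedAddCommGroup H] [InnerProductSpace ℂ H] [CompleteSpace H]

lemma exists_bound (A : StrictlyPositiveOperator H) :
    ∃ C : ℝ, 0 < C ∧ ∀ x y : H, (x, y) ∈ A.op.graph → ‖x‖ ≤ C * ‖y‖ := by
  obtain ⟨c, hc, h⟩ := A.coercive
  refine ⟨c⁻¹, inv_pos.2 hc, ?_⟩
  intro x y hxy
  obtain ⟨z, rfl, rfl⟩ := (LinearPMap.mem_graph_iff _).1 hxy
  have h1 := h z
  have h2 : (inner ℂ (A.op z) (z : H)).re ≤ ‖A.op z‖ * ‖(z : H)‖ :=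
    re_inner_le_norm (𝕜 := ℂ) _ _
  rw [inv_mul_eq_div, le_div_iff₀ hc]
  rcases eq_or_lt_of_le (norm_nonneg (z : H)) with h0 | h0
  · rw [← h0]; simp
  · nlinarith

lemma eq_zero_of_orthogonal_range (A : StrictlyPositiveOperator H) (y : H)
    (hy : ∀ x : A.op.domain, inner ℂ y (A.op x) = 0) : y = 0 := by
  have hd := A.selfAdjoint.dense_domain
  have hmem : y ∈ A.op.adjoint.domain :=
    LinearPMap.mem_adjoint_domain_of_exists y ⟨0, fun x => by simp [hy x]⟩
  have hval : A.op.adjoint ⟨y, hmem⟩ = 0 :=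
    LinearPMap.adjoint_apply_eq hd ⟨y, hmem⟩ fun x => by simp [hy x]
  have hg : (y, (0 : H)) ∈ A.op.adjoint.graph :=
    (LinearPMap.mem_graph_iff _).2 ⟨⟨y, hmem⟩, rfl, hval⟩
  rw [show A.op.adjoint = A.op from A.selfAdjoint] at hg
  obtain ⟨C, -, h⟩ := A.exists_bound
  simpa using h _ _ hg

lemma exists_graph (A : StrictlyPositiveOperator H) (y : H) : ∃ x, (x, y) ∈ A.op.graph := by
  obtain ⟨C, hC, h⟩ := A.exists_bound
  let f : A.op.graph →L[ℂ] H := (ContinuousLinearMap.snd ℂ H H).comp A.op.graph.subtypeL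
  have hcl : _root_.IsClosed (A.op.graph : Set (H × H)) := A.selfAdjoint.isClosed
  have : CompleteSpace A.op.graph := hcl.completeSpace_coe
  have hanti : AntilipschitzWith (Real.toNNReal (C + 1)) f := by
    refine f.antilipschitz_of_bound ?_
    rintro ⟨⟨x, z⟩, hx⟩
    have := h x z hx
    have hz := norm_nonneg z
    rw [Real.coe_toNNReal _ (by positivity)]
    change ‖(x, z)‖ ≤ (C + 1) * ‖z‖
    rw [Prod.norm_def, max_le_iff]
    constructor <;> simp only <;> nlinarith
  have hr : _root_.IsClosed (Set.range f) := hanti.isClosed_range f.uniformContinuous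
  have hbot : (LinearMap.range f.toLinearMap)ᗮ = ⊥ := by
    rw [Submodule.eq_bot_iff]
    intro z hz
    refine A.eq_zero_of_orthogonal_range z fun x => ?_
    rw [Submodule.mem_orthogonal'] at hz
    exact hz _ ⟨⟨_, A.op.mem_graph x⟩, rfl⟩
  rw [← Submodule.topologicalClosure_eq_top_iff] at hbot
  have hy : y ∈ (LinearMap.range f.toLinearMap).topologicalClosure := by rw [hbot]; trivial
  have hy' : y ∈ closure (Set.range f) := hy
  rw [hr.closure_eq] at hy'
  obtain ⟨⟨⟨x, z⟩, hx⟩, rfl⟩ := hy'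
  exact ⟨x, hx⟩

lemma exists_inv (A : StrictlyPositiveOperator H) :
    ∃ B : H →L[ℂ] H, ∀ y, (B y, y) ∈ A.op.graph := by
  obtain ⟨C, hC, h⟩ := A.exists_bound
  choose g hg using A.exists_graph
  have huniq : ∀ x x' y, (x, y) ∈ A.op.graph → (x', y) ∈ A.op.graph → x = x' := by
    intro x x' y hx hx'
    have := h _ _ (A.op.graph.sub_mem hx hx')
    simpa [sub_eq_zero] using this
  let L : H →ₗ[ℂ] H :=
    { toFun := g
      map_add' := fun a b => huniq _ _ _ (hg _) (A.op.graph.add_mem (hg a) (hg b))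
      map_smul' := fun a b => huniq _ _ _ (hg _) (A.op.graph.smul_mem a (hg b)) }
  exact ⟨L.mkContinuous C fun y => h _ _ (hg y), hg⟩

/-- The bounded inverse `A⁻¹`, characterised by `A (A⁻¹ y) = y`. -/
def inv (A : StrictlyPositiveOperator H) : H →L[ℂ] H := Classical.choose A.exists_inv

lemma inv_spec (A : StrictlyPositiveOperator H) (y : H) : (A.inv y, y) ∈ A.op.graph :=
  Classical.choose_spec A.exists_inv y

lemma inv_injective (A : StrictlyPositiveOperator H) : Function.Injective A.inv := by
  intro y y' hyy
  have h1 := A.inv_spec y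
  rw [hyy] at h1
  exact A.op.mem_graph_snd_inj h1 (A.inv_spec y') rfl

lemma inv_nonneg (A : StrictlyPositiveOperator H) : 0 ≤ A.inv := by
  rw [ContinuousLinearMap.nonneg_iff_isPositive, ContinuousLinearMap.isPositive_iff_complex]
  intro y
  obtain ⟨x, hx, hy⟩ := (LinearPMap.mem_graph_iff _).1 (A.inv_spec y)
  have hd := A.selfAdjoint.dense_domain
  have hfa := LinearPMap.adjoint_isFormalAdjoint hd
  rw [show A.op.adjoint = A.op from A.selfAdjoint] at hfa
  have hs : inner ℂ (A.op x) (x : H) = inner ℂ (x : H) (A.op x) := (hfa x x)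
  obtain ⟨c, hc, h⟩ := A.coercive
  have hcx := h x
  simp only at hx hy
  rw [← hx, ← hy, ← hs]
  refine ⟨?_, le_trans (by positivity) hcx⟩
  have : (starRingEnd ℂ) (inner ℂ (A.op x) (x : H)) = inner ℂ (A.op x) (x : H) := by
    rw [inner_conj_symm, hs]
  exact Complex.conj_eq_iff_re.1 this

/-- Powers of `A⁻¹` (taken in the continuous functional calculus) are injective. -/
lemma inv_rpow_injective (A : StrictlyPositiveOperator H) {r : ℝ} (hr : 0 ≤ r) :
    Function.Injective (A.inv ^ r : H →L[ℂ] H) := by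
  rcases hr.eq_or_lt with rfl | hr
  · rw [CFC.rpow_zero _ A.inv_nonneg]
    exact Function.injective_id
  obtain ⟨n, hn⟩ := exists_nat_gt r
  have h1 : A.inv ^ n = A.inv ^ (n - r) * (A.inv ^ r : H →L[ℂ] H) := by
    have ha : 0 < (n - r).toNNReal := Real.toNNReal_pos.2 (sub_pos.2 hn)
    have hb : 0 < r.toNNReal := Real.toNNReal_pos.2 hr
    have h2 := CFC.nnrpow_add (a := A.inv) ha hb
    rw [CFC.nnrpow_eq_rpow (add_pos ha hb), CFC.nnrpow_eq_rpow ha, CFC.nnrpow_eq_rpow hb,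
      NNReal.coe_add, Real.coe_toNNReal _ (sub_pos.2 hn).le, Real.coe_toNNReal _ hr.le,
      sub_add_cancel, CFC.rpow_natCast _ n A.inv_nonneg] at h2
    exact h2
  have h3 : Function.Injective (A.inv ^ n : H →L[ℂ] H) := by
    clear h1 hn
    induction n with
    | zero => exact Function.injective_id
    | succ k ih => rw [pow_succ]; exact ih.comp A.inv_injective
  rw [h1] at h3
  exact Function.Injective.of_comp h3

/-- The fractional power `A ^ r`, `r ∈ ℝ`: for `r ≤ 0` it is the everywhere defined bounded operator
`(A⁻¹) ^ (-r)`, given by the continuous functional calculus; for `r > 0` it is the (in general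
unbounded) inverse of the bounded injective operator `A ^ (-r) = (A⁻¹) ^ r`. -/
def pow (A : StrictlyPositiveOperator H) (r : ℝ) : H →ₗ.[ℂ] H :=
  if r ≤ 0 then (A.inv ^ (-r) : H →L[ℂ] H).toLinearMap.toPMap ⊤
  else ((A.inv ^ r : H →L[ℂ] H).toLinearMap.toPMap ⊤).inverse

lemma mem_graph_pow_of_nonpos (A : StrictlyPositiveOperator H) {r : ℝ} (hr : r ≤ 0) (x y : H) :
    (x, y) ∈ (A.pow r).graph ↔ (A.inv ^ (-r) : H →L[ℂ] H) x = y := by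
  rw [pow, if_pos hr, LinearPMap.mem_graph_iff]
  constructor
  · rintro ⟨z, rfl, rfl⟩; rfl
  · intro h; exact ⟨⟨x, trivial⟩, rfl, h⟩

lemma mem_graph_pow_of_nonneg (A : StrictlyPositiveOperator H) {r : ℝ} (hr : 0 ≤ r) (x y : H) :
    (x, y) ∈ (A.pow r).graph ↔ (A.inv ^ r : H →L[ℂ] H) y = x := by
  rcases hr.eq_or_lt with rfl | hr
  · rw [mem_graph_pow_of_nonpos _ le_rfl, neg_zero, CFC.rpow_zero _ A.inv_nonneg]
    exact eq_comm
  have hker : ((A.inv ^ r : H →L[ℂ] H).toLinearMap.toPMap ⊤).toFun.ker = ⊥ := by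
    rw [LinearMap.ker_eq_bot]
    intro a b hab
    exact Subtype.ext (A.inv_rpow_injective hr.le hab)
  rw [pow, if_neg hr.not_ge, LinearPMap.inverse_graph hker]
  simp only [Submodule.mem_map]
  constructor
  · rintro ⟨⟨a, b⟩, hab, h⟩
    obtain ⟨z, hz1, hz2⟩ := (LinearPMap.mem_graph_iff _).1 hab
    simp only [LinearEquiv.coe_coe, LinearEquiv.prodComm_apply, Prod.swap_prod_mk,
      Prod.mk.injEq] at h hz1 hz2
    rw [← h.1, ← h.2, ← hz1, ← hz2]
    rfl
  · intro h
    exact ⟨(y, x), (LinearPMap.mem_graph_iff _).2 ⟨⟨y, trivial⟩, rfl, h⟩, rfl⟩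

/-- The first power is the operator itself. -/
lemma pow_one (A : StrictlyPositiveOperator H) : A.pow 1 = A.op := by
  refine LinearPMap.eq_of_eq_graph (Submodule.ext ?_)
  rintro ⟨x, y⟩
  rw [mem_graph_pow_of_nonneg _ zero_le_one, CFC.rpow_one _ A.inv_nonneg]
  constructor
  · rintro rfl; exact A.inv_spec y
  · intro h
    obtain ⟨C, -, hC⟩ := A.exists_bound
    have := hC _ _ (A.op.graph.sub_mem (A.inv_spec y) h)
    simpa [sub_eq_zero] using this

lemma pow_injective (A : StrictlyPositiveOperator H) {r : ℝ} (x : (A.pow r).domain)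
    (h : A.pow r x = 0) : x = 0 := by
  have hg := (A.pow r).mem_graph x
  rw [h] at hg
  rcases le_total r 0 with hr | hr
  · rw [A.mem_graph_pow_of_nonpos hr] at hg
    exact Subtype.ext (A.inv_rpow_injective (neg_nonneg.2 hr) (by simpa using hg))
  · rw [A.mem_graph_pow_of_nonneg hr, map_zero] at hg
    exact Subtype.ext hg.symm

/-! ### The Hilbert spaces of the problem -/

/-- The space `H^r = D(A^{r/2})`, `r ≥ 0`, with inner product `⟪A^{r/2} u, A^{r/2} v⟫`. -/
def Hs (A : StrictlyPositiveOperator H) (r : ℝ) : Type _ := (A.pow (r / 2)).domain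

namespace Hs

variable {A : StrictlyPositiveOperator H} {r : ℝ}

instance : AddCommGroup (A.Hs r) := inferInstanceAs (AddCommGroup (A.pow (r / 2)).domain)

instance : Module ℂ (A.Hs r) := inferInstanceAs (Module ℂ (A.pow (r / 2)).domain)

/-- The inclusion `H^r → H`. -/
def val : A.Hs r →ₗ[ℂ] H := (A.pow (r / 2)).domain.subtype

/-- The map `A^{r/2} : H^r → H`. -/
def powHalf : A.Hs r →ₗ[ℂ] H := (A.pow (r / 2)).toFun

lemma powHalf_eq_zero (u : A.Hs r) (h : powHalf u = 0) : u = 0 := A.pow_injective u h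

/-- The inner product `⟪A^{r/2} u, A^{r/2} v⟫`. -/
@[reducible] def core : InnerProductSpace.Core ℂ (A.Hs r) where
  inner u v := inner ℂ (powHalf u) (powHalf v)
  conj_inner_symm u v := inner_conj_symm _ _
  re_inner_nonneg u := inner_self_nonneg
  add_left u v w := by rw [map_add, inner_add_left]
  smul_left u v a := by rw [map_smul, inner_smul_left]
  definite u h := powHalf_eq_zero u (inner_self_eq_zero.1 h)

instance : NormedAddCommGroup (A.Hs r) := (core (A := A) (r := r)).toNormedAddCommGroup

instance : InnerProductSpace ℂ (A.Hs r) :=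
  InnerProductSpace.ofCore (core (A := A) (r := r)).toCore

lemma norm_eq (u : A.Hs r) : ‖u‖ = ‖powHalf u‖ := by
  have h : ‖u‖ ^ 2 = ‖powHalf u‖ ^ 2 := by
    rw [norm_sq_eq_re_inner (𝕜 := ℂ) u, norm_sq_eq_re_inner (𝕜 := ℂ) (powHalf u)]
    rfl
  exact (pow_left_inj₀ (norm_nonneg _) (norm_nonneg _) two_ne_zero).1 h

/-- `H^r`, `r ≥ 0`, is isometric to `H`, hence a Hilbert space. -/
lemma completeSpace (hr : 0 ≤ r) : CompleteSpace (A.Hs r) := by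
  have hsurj : Function.Surjective (powHalf : A.Hs r →ₗ[ℂ] H) := by
    intro y
    obtain ⟨x, -, hy⟩ := (LinearPMap.mem_graph_iff _).1
      ((A.mem_graph_pow_of_nonneg (by positivity : (0 : ℝ) ≤ r / 2) _ y).2 rfl)
    exact ⟨x, hy⟩
  let e : A.Hs r ≃ₗ[ℂ] H := LinearEquiv.ofBijective powHalf
    ⟨(injective_iff_map_eq_zero _).2 powHalf_eq_zero, hsurj⟩
  let e' : A.Hs r ≃ₗᵢ[ℂ] H := ⟨e, fun u => (norm_eq u).symm⟩
  exact (completeSpace_congr (e := e'.toEquiv) e'.isometry.isUniformEmbedding).2 inferInstance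

instance : CompleteSpace (A.Hs 2) := completeSpace zero_le_two

end Hs

/-- The space `H^1 = D(A^{1/2})` with inner product `⟪z₁, z₂⟫ + ω ⟪A^{1/2} z₁, A^{1/2} z₂⟫`. -/
def H1 (A : StrictlyPositiveOperator H) (ω : ℝ) (_hω : 0 < ω) : Type _ := A.Hs 1

namespace H1

variable {A : StrictlyPositiveOperator H} {ω : ℝ} {hω : 0 < ω}

instance : AddCommGroup (A.H1 ω hω) := inferInstanceAs (AddCommGroup (A.Hs 1))

instance : Module ℂ (A.H1 ω hω) := inferInstanceAs (Module ℂ (A.Hs 1))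

/-- The inclusion `H^1 → H`. -/
def val : A.H1 ω hω →ₗ[ℂ] H := Hs.val (A := A) (r := 1)

/-- The map `A^{1/2} : H^1 → H`. -/
def powHalf : A.H1 ω hω →ₗ[ℂ] H := Hs.powHalf (A := A) (r := 1)

/-- The pairing `⟨(I + ω A) z₁, z₂⟩ = ⟪z₁, z₂⟫ + ω ⟪A^{1/2} z₁, A^{1/2} z₂⟫` between `H^{-1}` and
`H^1`. -/
def pairing (z₁ z₂ : A.H1 ω hω) : ℂ :=
  inner ℂ (val z₁) (val z₂) + (ω : ℂ) * inner ℂ (powHalf z₁) (powHalf z₂)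

lemma pairing_add (p p' z : A.H1 ω hω) : pairing (p + p') z = pairing p z + pairing p' z := by
  simp only [pairing, map_add, inner_add_left]
  ring

lemma pairing_smul (c : ℂ) (p z : A.H1 ω hω) :
    pairing (c • p) z = (starRingEnd ℂ) c * pairing p z := by
  simp only [pairing, map_smul, inner_smul_left]
  ring

lemma pairing_self_re (z : A.H1 ω hω) :
    (pairing z z).re = ‖val z‖ ^ 2 + ω * ‖powHalf z‖ ^ 2 := by
  have h1 : inner ℂ (val z) (val z) = ((‖val z‖ ^ 2 : ℝ) : ℂ) := by
    simp
  have h2 : inner ℂ (powHalf z) (powHalf z) = ((‖powHalf z‖ ^ 2 : ℝ) : ℂ) := by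
    simp
  rw [pairing, h1, h2, ← Complex.ofReal_mul, ← Complex.ofReal_add, Complex.ofReal_re]

/-- The inner product of `H^1` for which `I + ω A : H^1 → H^{-1}` is isometric. -/
@[reducible] def core : InnerProductSpace.Core ℂ (A.H1 ω hω) where
  inner := pairing
  conj_inner_symm u v := by
    simp only [pairing, map_add, map_mul, inner_conj_symm, Complex.conj_ofReal]
  re_inner_nonneg u := by
    change 0 ≤ (pairing u u).re
    rw [pairing_self_re]
    positivity
  add_left u v w := pairing_add u v w
  smul_left u v a := pairing_smul a u v
  definite u h := by
    have h1 : (pairing u u).re = 0 := by rw [h]; rfl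
    rw [pairing_self_re] at h1
    have h2 : ‖powHalf u‖ ^ 2 = 0 := by
      have := mul_nonneg hω.le (sq_nonneg ‖powHalf u‖)
      have h3 : ω * ‖powHalf u‖ ^ 2 = 0 := by nlinarith [sq_nonneg ‖val u‖]
      exact (mul_eq_zero.1 h3).resolve_left hω.ne'
    have h4 : powHalf u = 0 := by simpa using h2
    exact Hs.powHalf_eq_zero (A := A) (r := 1) u h4

instance : NormedAddCommGroup (A.H1 ω hω) :=
  (core (A := A) (ω := ω) (hω := hω)).toNormedAddCommGroup

instance : InnerProductSpace ℂ (A.H1 ω hω) :=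
  InnerProductSpace.ofCore (core (A := A) (ω := ω) (hω := hω)).toCore

lemma inner_eq_pairing (p z : A.H1 ω hω) : inner ℂ p z = pairing p z := rfl

lemma norm_sq (z : A.H1 ω hω) : ‖z‖ ^ 2 = ‖val z‖ ^ 2 + ω * ‖powHalf z‖ ^ 2 := by
  rw [← pairing_self_re, ← inner_eq_pairing]
  exact norm_sq_eq_re_inner (𝕜 := ℂ) z

lemma norm_powHalf_le (z : A.H1 ω hω) : ‖powHalf z‖ ≤ (√ω)⁻¹ * ‖z‖ := by
  have hs : 0 < √ω := Real.sqrt_pos.2 hω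
  rw [inv_mul_eq_div, le_div_iff₀ hs]
  refine abs_le_of_sq_le_sq' ?_ (norm_nonneg z) |>.2
  rw [norm_sq, mul_pow, Real.sq_sqrt hω.le]
  nlinarith [sq_nonneg ‖val z‖]

/-- `H^1` with this inner product is a Hilbert space. -/
instance : CompleteSpace (A.H1 ω hω) := by
  have hg : ∀ y : H, ∃ z : A.H1 ω hω, powHalf z = y ∧ val z = (A.inv ^ (1 / 2 : ℝ) : H →L[ℂ] H) y := by
    intro y
    obtain ⟨x, hx, hy⟩ := (LinearPMap.mem_graph_iff _).1
      ((A.mem_graph_pow_of_nonneg (by norm_num : (0 : ℝ) ≤ 1 / 2) _ y).2 rfl)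
    exact ⟨x, hy, hx⟩
  let e : A.H1 ω hω ≃ₗ[ℂ] H := LinearEquiv.ofBijective powHalf
    ⟨(injective_iff_map_eq_zero _).2 fun z hz => Hs.powHalf_eq_zero (A := A) (r := 1) z hz,
      fun y => (hg y).imp fun z hz => hz.1⟩
  have hval : ∀ z : A.H1 ω hω, val z = (A.inv ^ (1 / 2 : ℝ) : H →L[ℂ] H) (powHalf z) := by
    intro z
    obtain ⟨z', h1, h2⟩ := hg (powHalf z)
    have : z' = z := e.injective h1
    rw [← this, h2, h1]
  let K : ℝ := ‖(A.inv ^ (1 / 2 : ℝ) : H →L[ℂ] H)‖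
  let e' : A.H1 ω hω ≃L[ℂ] H := e.toContinuousLinearEquivOfBounds (√ω)⁻¹ (K + √ω)
    norm_powHalf_le (by
      intro y
      obtain ⟨z, rfl⟩ := e.surjective y
      rw [e.symm_apply_apply]
      change ‖z‖ ≤ (K + √ω) * ‖powHalf z‖
      have hK : ‖val z‖ ≤ K * ‖powHalf z‖ := by
        rw [hval]; exact ContinuousLinearMap.le_opNorm _ _
      have hK0 : 0 ≤ K := norm_nonneg _
      have hs : 0 ≤ √ω := Real.sqrt_nonneg ω
      have hn := norm_nonneg (powHalf z)
      refine abs_le_of_sq_le_sq' ?_ (by positivity) |>.2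
      rw [norm_sq]
      nlinarith [Real.sq_sqrt hω.le, mul_nonneg (mul_nonneg hK0 hs) (sq_nonneg ‖powHalf z‖),
        mul_self_le_mul_self (norm_nonneg _) hK])
  exact (completeSpace_congr (e := e'.toEquiv) e'.isUniformEmbedding).2 inferInstance

/-- For every `b ∈ H` there is `p ∈ H^1` with `(I + ω A) p = A^{1/2} b` in `H^{-1}`. -/
lemma exists_pairing_eq (b : H) :
    ∃ p : A.H1 ω hω, ∀ z : A.H1 ω hω, pairing p z = inner ℂ b (powHalf z) := by
  let T : A.H1 ω hω →L[ℂ] H := powHalf.mkContinuous (√ω)⁻¹ norm_powHalf_le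
  exact ⟨T.adjoint b, fun z => T.adjoint_inner_left z b⟩

end H1

/-- The phase space `H^2 × H^1 × H`, with the Hilbert product norm. -/
abbrev PhaseSpace (A : StrictlyPositiveOperator H) (ω : ℝ) (hω : 0 < ω) : Type _ :=
  WithLp 2 (A.Hs 2 × WithLp 2 (A.H1 ω hω × H))

namespace PhaseSpace

variable {A : StrictlyPositiveOperator H} {ω : ℝ} {hω : 0 < ω}

/-- The displacement component, in `H^2`. -/
def u (U : A.PhaseSpace ω hω) : A.Hs 2 := U.fst

/-- The velocity component, in `H^1`. -/
def v (U : A.PhaseSpace ω hω) : A.H1 ω hω := U.snd.fst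

/-- The temperature component, in `H`. -/
def θ (U : A.PhaseSpace ω hω) : H := U.snd.snd

lemma ext' {U V : A.PhaseSpace ω hω} (h1 : U.u = V.u) (h2 : U.v = V.v) (h3 : U.θ = V.θ) :
    U = V := by
  apply WithLp.ofLp_injective
  refine Prod.ext h1 ?_
  apply WithLp.ofLp_injective
  exact Prod.ext h2 h3

end PhaseSpace

/-! ### The generator of the thermoelastic plate system -/

/-- The graph of the plate operator: the pairs `(U, F)`, `U = (u, v, θ)`, such that
* `v ∈ H^2` and `F.u = v`;
* `w := -u + A^{σ-2} θ` is in `H^3` and `F.v = (I + ω A)⁻¹ (A² w)`, that is, `(I + ω A) F.v = A² w`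
  in `H^{-1}`, where `⟨A² w, z⟩ = ⟪A^{3/2} w, A^{1/2} z⟫` for `z ∈ H^1`;
* `-θ - A^{σ-1} v ∈ H^2` and `F.θ = A (-θ - A^{σ-1} v)`. -/
def plateGraph (A : StrictlyPositiveOperator H) (ω : ℝ) (hω : 0 < ω) (σ : ℝ) :
    Submodule ℂ (A.PhaseSpace ω hω × A.PhaseSpace ω hω) where
  carrier := {p |
    Hs.val p.2.u = H1.val p.1.v ∧
    (∃ a b : H, (p.1.θ, a) ∈ (A.pow (σ - 2)).graph ∧
      (-Hs.val p.1.u + a, b) ∈ (A.pow (3 / 2)).graph ∧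
      ∀ z : A.H1 ω hω, H1.pairing p.2.v z = inner ℂ b (H1.powHalf z)) ∧
    (∃ a : H, (H1.val p.1.v, a) ∈ (A.pow (σ - 1)).graph ∧
      (-p.1.θ - a, p.2.θ) ∈ (A.pow 1).graph)}
  add_mem' := by
    rintro ⟨U, F⟩ ⟨U', F'⟩ ⟨h1, ⟨a, b, h2, h3, h4⟩, ⟨d, h5, h6⟩⟩
      ⟨h1', ⟨a', b', h2', h3', h4'⟩, ⟨d', h5', h6'⟩⟩
    refine ⟨?_, ⟨a + a', b + b', Submodule.add_mem _ h2 h2', ?_, fun z => ?_⟩,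
      ⟨d + d', Submodule.add_mem _ h5 h5', ?_⟩⟩
    · change Hs.val (F.u + F'.u) = H1.val (U.v + U'.v)
      rw [map_add, map_add]; exact congrArg₂ (· + ·) h1 h1'
    · change (-Hs.val (U.u + U'.u) + (a + a'), b + b') ∈ (A.pow (3 / 2)).graph
      convert Submodule.add_mem _ h3 h3' using 1
      rw [map_add, Prod.mk_add_mk]
      congr 1; abel
    · change H1.pairing (F.v + F'.v) z = _
      rw [H1.pairing_add, inner_add_left, h4 z, h4' z]
    · change (-(U.θ + U'.θ) - (d + d'), F.θ + F'.θ) ∈ (A.pow 1).graph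
      convert Submodule.add_mem _ h6 h6' using 1
      rw [Prod.mk_add_mk]
      congr 1; abel
  zero_mem' := by
    refine ⟨?_, ⟨0, 0, Submodule.zero_mem _, ?_, fun z => ?_⟩, ⟨0, ?_, ?_⟩⟩
    · change Hs.val (0 : A.Hs 2) = H1.val (0 : A.H1 ω hω)
      rw [map_zero, map_zero]
    · change (-Hs.val (0 : A.Hs 2) + 0, (0 : H)) ∈ (A.pow (3 / 2)).graph
      rw [map_zero, neg_zero, add_zero]; exact Submodule.zero_mem _
    · change H1.pairing (0 : A.H1 ω hω) z = _
      simp [H1.pairing]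
    · change (H1.val (0 : A.H1 ω hω), (0 : H)) ∈ (A.pow (σ - 1)).graph
      rw [map_zero]; exact Submodule.zero_mem _
    · change (-(0 : H) - 0, (0 : H)) ∈ (A.pow 1).graph
      rw [neg_zero, sub_zero]; exact Submodule.zero_mem _
  smul_mem' := by
    rintro c ⟨U, F⟩ ⟨h1, ⟨a, b, h2, h3, h4⟩, ⟨d, h5, h6⟩⟩
    refine ⟨?_, ⟨c • a, c • b, Submodule.smul_mem _ c h2, ?_, fun z => ?_⟩, ⟨c • d, ?_, ?_⟩⟩
    · change Hs.val (c • F.u) = H1.val (c • U.v)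
      rw [map_smul, map_smul]; exact congrArg (c • ·) h1
    · change (-Hs.val (c • U.u) + c • a, c • b) ∈ (A.pow (3 / 2)).graph
      convert Submodule.smul_mem _ c h3 using 1
      rw [map_smul, Prod.smul_mk, smul_add, smul_neg]
    · change H1.pairing (c • F.v) z = _
      rw [H1.pairing_smul, inner_smul_left, h4 z]
    · change (H1.val (c • U.v), c • d) ∈ (A.pow (σ - 1)).graph
      rw [map_smul]; exact Submodule.smul_mem _ c h5
    · change (-(c • U.θ) - c • d, c • F.θ) ∈ (A.pow 1).graph
      convert Submodule.smul_mem _ c h6 using 1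
      rw [Prod.smul_mk, smul_sub, smul_neg]

/-- The second component of the graph is determined by the first one. -/
lemma plateGraph_snd_eq_zero (A : StrictlyPositiveOperator H) (ω : ℝ) (hω : 0 < ω) (σ : ℝ)
    (p : A.PhaseSpace ω hω × A.PhaseSpace ω hω) (hp : p ∈ A.plateGraph ω hω σ) (h0 : p.1 = 0) :
    p.2 = 0 := by
  obtain ⟨U, F⟩ := p
  obtain ⟨h1, ⟨a, b, h2, h3, h4⟩, ⟨d, h5, h6⟩⟩ := hp
  simp only at h0
  subst h0
  have ha : a = 0 := (A.pow (σ - 2)).graph_fst_eq_zero_snd h2 rfl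
  subst ha
  have hu0 : Hs.val (0 : A.PhaseSpace ω hω).u = 0 := map_zero Hs.val
  have hv0 : H1.val (0 : A.PhaseSpace ω hω).v = 0 := map_zero H1.val
  have ht0 : (0 : A.PhaseSpace ω hω).θ = 0 := rfl
  have hb : b = 0 := (A.pow (3 / 2)).graph_fst_eq_zero_snd h3 (by simp only [hu0]; simp)
  subst hb
  have hd : d = 0 := (A.pow (σ - 1)).graph_fst_eq_zero_snd h5 hv0
  subst hd
  refine PhaseSpace.ext' ?_ ?_ ?_
  · exact Subtype.ext (h1.trans hv0)
  · have h7 := h4 F.v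
    rw [inner_zero_left] at h7
    exact H1.core.definite _ h7
  · exact (A.pow 1).graph_fst_eq_zero_snd h6 (by simp only [ht0]; simp)

/-- The operator `𝔸_ω (u, v, θ) = (v, (I + ω A)⁻¹ (-A² u + A^σ θ), -A θ - A^σ v)`, with domain
`{(u, v, θ) | v ∈ H^2, -u + A^{σ-2} θ ∈ H^3, -θ - A^{σ-1} v ∈ H^2}`. -/
def plateOperator (A : StrictlyPositiveOperator H) (ω : ℝ) (hω : 0 < ω) (σ : ℝ) :
    A.PhaseSpace ω hω →ₗ.[ℂ] A.PhaseSpace ω hω :=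
  (A.plateGraph ω hω σ).toLinearPMap

lemma plateOperator_graph (A : StrictlyPositiveOperator H) (ω : ℝ) (hω : 0 < ω) (σ : ℝ) :
    (A.plateOperator ω hω σ).graph = A.plateGraph ω hω σ :=
  Submodule.toLinearPMap_graph_eq _ (A.plateGraph_snd_eq_zero ω hω σ)

lemma mem_plateOperator_domain (A : StrictlyPositiveOperator H) (ω : ℝ) (hω : 0 < ω) (σ : ℝ)
    (U : A.PhaseSpace ω hω) :
    U ∈ (A.plateOperator ω hω σ).domain ↔
      H1.val U.v ∈ (A.pow (2 / 2)).domain ∧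
      (∃ a, (U.θ, a) ∈ (A.pow (σ - 2)).graph ∧ -Hs.val U.u + a ∈ (A.pow (3 / 2)).domain) ∧
      (∃ a, (H1.val U.v, a) ∈ (A.pow (σ - 1)).graph ∧ -U.θ - a ∈ (A.pow (2 / 2)).domain) := by
  have h22 : (2 / 2 : ℝ) = 1 := by norm_num
  change U ∈ (A.plateGraph ω hω σ).map (LinearMap.fst ℂ _ _) ↔ _
  constructor
  · rintro ⟨⟨U, F⟩, ⟨h1, ⟨a, b, h2, h3, h4⟩, ⟨d, h5, h6⟩⟩, rfl⟩
    refine ⟨?_, ⟨a, h2, LinearPMap.mem_domain_of_mem_graph h3⟩, ⟨d, h5, ?_⟩⟩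
    · rw [show H1.val ((LinearMap.fst ℂ _ _) (U, F)).v = Hs.val F.u from h1.symm]
      exact F.u.2
    · rw [h22]; exact LinearPMap.mem_domain_of_mem_graph h6
  · rintro ⟨h1, ⟨a, h2, h3⟩, ⟨d, h5, h6⟩⟩
    obtain ⟨p, hp⟩ := H1.exists_pairing_eq (A := A) (hω := hω) (A.pow (3 / 2) ⟨_, h3⟩)
    rw [h22] at h6
    let fu : A.Hs 2 := ⟨_, h1⟩
    refine ⟨(U, WithLp.toLp 2 (fu, WithLp.toLp 2 (p, A.pow 1 ⟨_, h6⟩))), ?_, rfl⟩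
    exact ⟨rfl, ⟨a, _, h2, (A.pow (3 / 2)).mem_graph ⟨_, h3⟩, hp⟩,
      ⟨d, h5, (A.pow 1).mem_graph ⟨_, h6⟩⟩⟩

end StrictlyPositiveOperator

/-! ### Semigroups of operators -/

/-- A strongly continuous semigroup of bounded operators on a complex normed space. -/
structure C0Semigroup (E : Type*) [NormedAddCommGroup E] [NormedSpace ℂ E] where
  toFun : ℝ≥0 → E →L[ℂ] E
  map_zero : toFun 0 = 1
  map_add : ∀ s t, toFun (s + t) = toFun s * toFun t
  strong_continuity : ∀ x, Tendsto (fun t => toFun t x) (𝓝 0) (𝓝 x)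

namespace C0Semigroup

variable {E : Type*} [NormedAddCommGroup E] [NormedSpace ℂ E]

/-- The graph of the infinitesimal generator: the pairs `(x, y)` with
`(S(t) x - x) / t → y` as `t → 0`, `t > 0`. -/
def generatorGraph (S : C0Semigroup E) : Submodule ℂ (E × E) where
  carrier := {p | Tendsto (fun t : ℝ≥0 => ((t : ℝ) : ℂ)⁻¹ • (S.toFun t p.1 - p.1)) (𝓝[≠] 0) (𝓝 p.2)}
  add_mem' := by
    intro p q hp hq
    refine (Tendsto.add hp hq).congr fun t => ?_
    rw [← smul_add, Prod.fst_add, _root_.map_add]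
    congr 1; abel
  zero_mem' := by simp
  smul_mem' := by
    intro c p hp
    refine (Tendsto.const_smul hp c).congr fun t => ?_
    rw [Prod.smul_fst, map_smul, ← smul_sub, smul_comm]

lemma generatorGraph_snd_eq_zero (S : C0Semigroup E) (p : E × E) (hp : p ∈ S.generatorGraph)
    (h0 : p.1 = 0) : p.2 = 0 := by
  have h : Tendsto (fun t : ℝ≥0 => ((t : ℝ) : ℂ)⁻¹ • (S.toFun t p.1 - p.1)) (𝓝[≠] 0) (𝓝 p.2) := hp
  simp only [h0, _root_.map_zero, sub_zero, smul_zero] at h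
  exact tendsto_nhds_unique h tendsto_const_nhds

/-- The infinitesimal generator. -/
def generator (S : C0Semigroup E) : E →ₗ.[ℂ] E := S.generatorGraph.toLinearPMap

lemma generator_graph (S : C0Semigroup E) : S.generator.graph = S.generatorGraph :=
  Submodule.toLinearPMap_graph_eq _ S.generatorGraph_snd_eq_zero

/-- A semigroup of contractions. -/
def IsContractive (S : C0Semigroup E) : Prop := ∀ t, ‖S.toFun t‖ ≤ 1

/-- The open sector `{z ≠ 0 | |arg z| < φ}`. -/
def sector (φ : ℝ) : Set ℂ := {z | z ≠ 0 ∧ |z.arg| < φ}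

/-- A strongly continuous semigroup is analytic if it extends to an operator family on some open
sector around the positive half-line which is holomorphic (for the operator norm), satisfies the
semigroup law, and is strongly continuous at `0` within the sector. -/
def IsAnalytic (S : C0Semigroup E) : Prop :=
  ∃ φ : ℝ, 0 < φ ∧ φ ≤ Real.pi / 2 ∧ ∃ T : ℂ → E →L[ℂ] E,
    (∀ t : ℝ≥0, T ((t : ℝ) : ℂ) = S.toFun t) ∧
    DifferentiableOn ℂ T (sector φ) ∧
    (∀ z ∈ sector φ, ∀ w ∈ sector φ, T (z + w) = T z * T w) ∧
    ∀ x, Tendsto (fun z => T z x) (𝓝[sector φ] 0) (𝓝 x)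

end C0Semigroup

end

/-!
In the coordinates `A u`, `A^{1/2} v`, `θ` the plate operator `𝔸_ω` has an explicit bounded inverse
`K` built from negative powers of `A`: given `F = 𝔸_ω U`, the first equation gives `v`, the third `θ`
and the second `u` (`mem_plateGraph_iff`). All estimates are made on pairs `(F, K F)`, so that no
unbounded operator occurs.

With `p = A^{5/2-σ} u`, `q = A^{σ-1/2} v` and `r = A^{1/2} θ`, the energy identity is
`Re ⟪F, K F⟫ = -‖r‖²`. It shows dissipativity, but damps the temperature only. Adding to the energy
small multiples of the forms `⟪A^{σ-1} v, θ⟫` and `⟪A^{3-2σ} u, v⟫`, the latter in `H^1`, gives an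
equivalent inner product in which `q` and `p` are damped as well. The added forms are bounded,
and the errors they cause are absorbed, because `5/4 ≤ σ ≤ 3/2`. The whole form, real and imaginary
part, is bounded by `‖p‖² + ‖q‖² + ‖r‖²`; hence the numerical range of `𝔸_ω` in this inner product
lies in a sector around the negative half-line (`exists_isSectorialInverse`).

Such an operator generates an analytic contraction semigroup (`IsSectorialInverse.exists_semigroup`).
Its Yosida approximations are `G_ε = (K - ε)⁻¹`, and `z G_ε` is dissipative in the new inner product
for `z` in a cone around the positive half-line, so that `exp (z G_ε)` is bounded uniformly in `ε` and
`z`; for `z ≥ 0` it is a contraction in the original norm. By the resolvent identity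
`G_ε - G_δ = (ε - δ) G_ε G_δ` these exponentials converge on the dense range of `K²`, hence strongly,
uniformly on bounded parts of the cone. The limit is strongly holomorphic, and being bounded it is
holomorphic in norm.
-/

noncomputable section

/-! ### Exponentials of bounded dissipative operators -/

/-- A symmetric bounded operator `Q` with `q ‖x‖² ≤ ⟪Q x, x⟫`, so that `⟪Q x, y⟫` is an equivalent
inner product. -/
structure IsCoerciveWeight {X : Type*} [NormedAddCommGroup X] [InnerProductSpace ℂ X]
    (Q : X →L[ℂ] X) (q : ℝ) : Prop where
  symm : ∀ x y, inner ℂ (Q x) y = inner ℂ x (Q y)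
  pos : 0 < q
  le : ∀ x, q * ‖x‖ ^ 2 ≤ (inner ℂ (Q x) x).re

lemma isCoerciveWeight_one {X : Type*} [NormedAddCommGroup X] [InnerProductSpace ℂ X] :
    IsCoerciveWeight (1 : X →L[ℂ] X) 1 where
  symm _ _ := rfl
  pos := one_pos
  le x := by
    rw [one_mul, one_apply_eq_self]
    exact (norm_sq_eq_re_inner (𝕜 := ℂ) x).le

lemma IsCoerciveWeight.im_eq_zero {X : Type*} [NormedAddCommGroup X] [InnerProductSpace ℂ X]
    {Q : X →L[ℂ] X} {q : ℝ} (hQ : IsCoerciveWeight Q q) (x : X) :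
    (inner ℂ (Q x) x).im = 0 := by
  have h : (starRingEnd ℂ) (inner ℂ (Q x) x) = inner ℂ (Q x) x := by
    rw [inner_conj_symm, hQ.symm]
  exact Complex.conj_eq_iff_im.1 h

/-- If `L` is dissipative for the inner product with weight `Q`, then `exp L` is bounded
independently of `L`. -/
lemma norm_exp_apply_le {X : Type*} [NormedAddCommGroup X] [InnerProductSpace ℂ X] 
    [CompleteSpace X] {Q : X →L[ℂ] X} {q : ℝ} (hQ : IsCoerciveWeight Q q) (L : X →L[ℂ] X)
    (hL : ∀ x, (inner ℂ (Q (L x)) x).re ≤ 0) (x : X) :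
    ‖NormedSpace.exp L x‖ ≤ √(‖Q‖ / q) * ‖x‖ := by
  let y : ℝ → X := fun t => NormedSpace.exp (t • L) x
  have hy : ∀ t, HasDerivAt y (L (y t)) t := by
    intro t
    have h := hasDerivAt_exp_smul_const' (𝕂 := ℝ) L t
    exact ((ContinuousLinearMap.apply ℂ X x).restrictScalars ℝ).hasFDerivAt.comp_hasDerivAt t h
  let f : ℝ → ℝ := fun t => (inner ℂ (Q (y t)) (y t)).re
  have hf : ∀ t, HasDerivAt f (2 * (inner ℂ (Q (L (y t))) (y t)).re) t := by
    intro t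
    have h1 : HasDerivAt (fun t => Q (y t)) (Q (L (y t))) t :=
      (Q.restrictScalars ℝ).hasFDerivAt.comp_hasDerivAt t (hy t)
    have h2 := h1.inner ℂ (hy t)
    have h3 := Complex.reCLM.hasFDerivAt.comp_hasDerivAt t h2
    refine h3.congr_deriv ?_
    have h4 : (inner ℂ (Q (y t)) (L (y t))).re = (inner ℂ (Q (L (y t))) (y t)).re := by
      rw [hQ.symm, ← inner_conj_symm, Complex.conj_re]
    simp only [Complex.reCLM_apply, Complex.add_re, h4]
    ring
  have hanti : Antitone f :=
    antitone_of_deriv_nonpos (fun t => (hf t).differentiableAt) fun t => by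
      rw [(hf t).deriv]; linarith [hL (y t)]
  have h01 : f 1 ≤ f 0 := hanti zero_le_one
  have hy1 : y 1 = NormedSpace.exp L x := by simp [y]
  have hy0 : y 0 = x := by simp [y]
  simp only [f, hy0, hy1] at h01
  have h5 : (inner ℂ (Q x) x).re ≤ ‖Q‖ * ‖x‖ ^ 2 := by
    have h6 : (inner ℂ (Q x) x).re ≤ ‖Q x‖ * ‖x‖ := re_inner_le_norm (𝕜 := ℂ) _ _
    have h7 := Q.le_opNorm x
    nlinarith [norm_nonneg x]
  have h8 := hQ.le (NormedSpace.exp L x)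
  have hq := hQ.pos
  refine abs_le_of_sq_le_sq' ?_ (by positivity) |>.2
  rw [mul_pow, Real.sq_sqrt (by positivity), div_mul_eq_mul_div, le_div_iff₀ hq]
  linarith

/-- Comparison of the exponentials of two commuting operators along the segment joining them. -/
lemma norm_exp_sub_exp_apply_le {X : Type*} [NormedAddCommGroup X] [NormedSpace ℂ X]
    [CompleteSpace X] {L L' : X →L[ℂ] X} (hc : Commute L L') {M : ℝ}
    (hM : 0 ≤ M)
    (h : ∀ s : ℝ, 0 ≤ s → ∀ x, ‖NormedSpace.exp (s • L) x‖ ≤ M * ‖x‖)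
    (h' : ∀ s : ℝ, 0 ≤ s → ∀ x, ‖NormedSpace.exp (s • L') x‖ ≤ M * ‖x‖) (x : X) :
    ‖NormedSpace.exp L x - NormedSpace.exp L' x‖ ≤ M ^ 2 * ‖(L - L') x‖ := by
  let D := L - L'
  have hcD : Commute L' D := hc.symm.sub_right (Commute.refl _)
  let y : ℝ → X := fun s => NormedSpace.exp L' (NormedSpace.exp (s • D) x)
  have hy : ∀ s, HasDerivAt y (NormedSpace.exp L' (NormedSpace.exp (s • D) (D x))) s := by
    intro s
    have h1 := hasDerivAt_exp_smul_const (𝕂 := ℝ) D s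
    have h2 := ((ContinuousLinearMap.apply ℂ X x).restrictScalars ℝ).hasFDerivAt.comp_hasDerivAt s h1
    exact ((NormedSpace.exp L').restrictScalars ℝ).hasFDerivAt.comp_hasDerivAt s h2
  have key : ∀ s : ℝ, NormedSpace.exp L' * NormedSpace.exp (s • D) =
      NormedSpace.exp ((1 - s) • L') * NormedSpace.exp (s • L) := by
    intro s
    let _ : NormedAlgebra ℚ (X →L[ℂ] X) := NormedAlgebra.restrictScalars ℚ ℂ _
    rw [← NormedSpace.exp_add_of_commute (hcD.smul_right s),
      ← NormedSpace.exp_add_of_commute ((hc.symm.smul_right s).smul_left (1 - s))]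
    congr 1
    simp only [D, smul_sub, sub_smul, one_smul]
    abel
  have h3 := norm_image_sub_le_of_norm_deriv_le_segment_01' (f := y) (C := M ^ 2 * ‖D x‖)
    (fun s _ => (hy s).hasDerivWithinAt) (by
      intro s hs
      have h4 := congrArg (fun T : X →L[ℂ] X => T (D x)) (key s)
      simp only [mul_apply_eq_comp] at h4
      rw [h4]
      have h5 := h' (1 - s) (by linarith [hs.2]) (NormedSpace.exp (s • L) (D x))
      have h6 := h s hs.1 (D x)
      nlinarith)
  have hy1 : y 1 = NormedSpace.exp L x := by
    have h4 := congrArg (fun T : X →L[ℂ] X => T x) (key 1)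
    simpa [y] using h4
  have hy0 : y 0 = NormedSpace.exp L' x := by simp [y]
  rwa [hy0, hy1] at h3

/-- First order Taylor estimate for the exponential of a bounded operator. -/
lemma norm_exp_sub_sub_apply_le {X : Type*} [NormedAddCommGroup X] [NormedSpace ℂ X]
    [CompleteSpace X] (L : X →L[ℂ] X) (x : X) {δ : ℝ}
    (h : ∀ s : ℝ, 0 ≤ s → s ≤ 1 → ‖NormedSpace.exp (s • L) (L x) - L x‖ ≤ δ) :
    ‖NormedSpace.exp L x - x - L x‖ ≤ δ := by
  let y : ℝ → X := fun s => NormedSpace.exp (s • L) x - s • L x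
  have hy : ∀ s, HasDerivAt y (NormedSpace.exp (s • L) (L x) - L x) s := by
    intro s
    have h1 := hasDerivAt_exp_smul_const (𝕂 := ℝ) L s
    have h2 := ((ContinuousLinearMap.apply ℂ X x).restrictScalars ℝ).hasFDerivAt.comp_hasDerivAt s h1
    have h3 := (hasDerivAt_id s).smul_const (L x)
    rw [one_smul] at h3
    exact h2.sub h3
  have h3 := norm_image_sub_le_of_norm_deriv_le_segment_01' (f := y) (C := δ)
    (fun s _ => (hy s).hasDerivWithinAt) (fun s hs => h s hs.1 hs.2.le)
  convert h3 using 2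
  simp [y]
  abel

/-! ### Strongly holomorphic operator families -/

/-- A bounded family of operators which is holomorphic in the strong sense is holomorphic for the
operator norm: it is Lipschitz by the Schwarz lemma, hence is the Cauchy integral of itself. -/
lemma differentiableOn_of_apply {X : Type*} [NormedAddCommGroup X] [NormedSpace ℂ X]
    [CompleteSpace X] {T : ℂ → X →L[ℂ] X} {U : Set ℂ} (hU : IsOpen U)
    {M : ℝ} (hM : ∀ z ∈ U, ‖T z‖ ≤ M) (hT : ∀ x, DifferentiableOn ℂ (fun z => T z x) U) :
    DifferentiableOn ℂ T U := by
  have hcont : ContinuousOn T U := by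
    intro c hc
    refine ContinuousAt.continuousWithinAt ?_
    obtain ⟨r, hr, hrU⟩ := Metric.isOpen_iff.1 hU c hc
    have hM0 : 0 ≤ M := (norm_nonneg _).trans (hM c hc)
    have hb : ∀ z ∈ Metric.ball c r, ‖T z - T c‖ ≤ 2 * M / r * dist z c := by
      intro z hz
      refine ContinuousLinearMap.opNorm_le_bound _ (by positivity) fun x => ?_
      have h1 := Complex.dist_le_div_mul_dist_of_mapsTo_ball (f := fun z => T z x) (R₁ := r)
        (R₂ := 2 * M * ‖x‖) ((hT x).mono hrU) (fun w hw => by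
          rw [mem_closedBall_iff_norm]
          have h2 := (T w).le_of_opNorm_le (hM w (hrU hw)) x
          have h3 := (T c).le_of_opNorm_le (hM c hc) x
          exact (norm_sub_le _ _).trans (by linarith)) hz
      rw [dist_eq_norm] at h1
      exact h1.trans (le_of_eq (by ring))
    rw [ContinuousAt, tendsto_iff_norm_sub_tendsto_zero]
    refine squeeze_zero' (Eventually.of_forall fun _ => norm_nonneg _)
      (mem_of_superset (Metric.ball_mem_nhds c hr) hb) ?_
    have h4 : Tendsto (fun z => 2 * M / r * dist z c) (𝓝 c) (𝓝 (2 * M / r * dist c c)) :=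
      (continuous_const.mul (continuous_id.dist continuous_const)).tendsto c
    simpa using h4
  intro c hc
  refine DifferentiableAt.differentiableWithinAt ?_
  obtain ⟨r, hr, hrU⟩ := Metric.nhds_basis_closedBall.mem_iff.1 (hU.mem_nhds hc)
  lift r to ℝ≥0 using hr.le
  have hci : CircleIntegrable T c r :=
    (hcont.mono (Metric.sphere_subset_closedBall.trans hrU)).circleIntegrable r.2
  have hp := (hasFPowerSeriesOn_cauchy_integral hci (by exact_mod_cast hr)).differentiableOn
  have hd := hp.differentiableAt
    (Metric.isOpen_eball.mem_nhds (Metric.mem_eball_self (by exact_mod_cast hr)))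
  refine hd.congr_of_eventuallyEq ?_
  filter_upwards [Metric.ball_mem_nhds c hr] with w hw
  ext x
  have hw' : ∀ z ∈ Metric.sphere c (r : ℝ), z - w ≠ 0 := by
    intro z hz h0
    rw [sub_eq_zero] at h0
    subst h0
    exact absurd hz (ne_of_lt hw)
  have hci' : CircleIntegrable (fun z => (z - w)⁻¹ • T z) c r := by
    refine ContinuousOn.circleIntegrable r.2 (ContinuousOn.fun_smul ?_
      (hcont.mono (Metric.sphere_subset_closedBall.trans hrU)))
    exact (continuousOn_id.sub continuousOn_const).inv₀ hw'
  have h1 := Complex.circleIntegral_sub_inv_smul_of_differentiable_on_off_countable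
    (f := fun z => T z x) Set.countable_empty hw ((hT x).continuousOn.mono hrU) fun z hz =>
      (hT x).differentiableAt (hU.mem_nhds (hrU (Metric.ball_subset_closedBall hz.1)))
  have h2 : (∮ z in C(c, (r : ℝ)), (z - w)⁻¹ • T z) x = ∮ z in C(c, (r : ℝ)), (z - w)⁻¹ • T z x := by
    have h3 := ContinuousLinearMap.intervalIntegral_comp_comm (ContinuousLinearMap.apply ℂ X x)
      hci'.out
    simp only [circleIntegral]
    exact h3.symm
  rw [smul_apply, h2, h1, smul_smul, inv_mul_cancel₀ Complex.two_pi_I_ne_zero,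
    one_smul]

/-! ### Generation of analytic contraction semigroups -/

/-- The bounded operator `K` is the inverse of a dissipative operator whose numerical range, taken
in the inner product with weight `Q`, lies in a sector around the negative half-line. For `𝔸 = K⁻¹` and
`y = K x` the conditions read `Re ⟪𝔸 y, y⟫ ≤ 0` and `|Im ⟪𝔸 y, y⟫_Q| ≤ - C Re ⟪𝔸 y, y⟫_Q`. -/
structure IsSectorialInverse {X : Type*} [NormedAddCommGroup X] [InnerProductSpace ℂ X]
    (K Q : X →L[ℂ] X) (q C : ℝ) : Prop where
  injective : Function.Injective K
  dissipative : ∀ x, (inner ℂ x (K x)).re ≤ 0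
  weight : IsCoerciveWeight Q q
  pos : 0 < C
  sector : ∀ x, |(inner ℂ (Q x) (K x)).im| ≤ -(C * (inner ℂ (Q x) (K x)).re)

/-- The bounded approximation `(K - ε)⁻¹`, `ε > 0`, of the operator `K⁻¹`; it is its Yosida
approximation with parameter `1 / ε`. -/
def yosida {X : Type*} [NormedAddCommGroup X] [InnerProductSpace ℂ X] (K : X →L[ℂ] X) (ε : ℝ) :
    X →L[ℂ] X :=
  Ring.inverse (K - (ε : ℂ) • 1)

/-- The closed cone `C |Im z| ≤ Re z`. -/
def closedCone (C : ℝ) : Set ℂ := {z | C * |z.im| ≤ z.re}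

lemma ofReal_mem_closedCone {C t : ℝ} (ht : 0 ≤ t) : (t : ℂ) ∈ closedCone C := by
  simpa [closedCone] using ht

lemma zero_mem_closedCone {C : ℝ} : (0 : ℂ) ∈ closedCone C := by simp [closedCone]

lemma add_mem_closedCone {C : ℝ} (hC : 0 < C) {z w : ℂ} (hz : z ∈ closedCone C)
    (hw : w ∈ closedCone C) : z + w ∈ closedCone C := by
  simp only [closedCone, Set.mem_ofPred_eq, Complex.add_im, Complex.add_re] at *
  nlinarith [abs_add_le z.im w.im]

lemma smul_mem_closedCone {C : ℝ} {z : ℂ} (hz : z ∈ closedCone C) {s : ℝ} (hs : 0 ≤ s) :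
    s • z ∈ closedCone C := by
  simp only [closedCone, Set.mem_ofPred_eq, Complex.smul_im, Complex.smul_re, smul_eq_mul, abs_mul,
    abs_of_nonneg hs] at *
  nlinarith

lemma sector_subset_interior_cone {C : ℝ} (hC : 0 < C) :
    C0Semigroup.sector (Real.arctan (1 / C)) ⊆ {z | C * |z.im| < z.re} := by
  rintro z ⟨hz, harg⟩
  have h1 : Real.arctan (1 / C) < Real.pi / 2 := Real.arctan_lt_pi_div_two _
  have hn : 0 < ‖z‖ := norm_pos_iff.2 hz
  have h2 : 0 < Real.cos |z.arg| := Real.cos_pos_of_mem_Ioo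
    ⟨by linarith [abs_nonneg z.arg, Real.pi_pos], by linarith⟩
  have h3 : Real.tan |z.arg| < 1 / C := by
    rw [← Real.tan_arctan (1 / C)]
    exact Real.tan_lt_tan_of_lt_of_lt_pi_div_two (by linarith [abs_nonneg z.arg, Real.pi_pos]) h1 harg
  rw [Real.tan_eq_sin_div_cos, div_lt_div_iff₀ h2 hC, one_mul] at h3
  have h4 : z.re = ‖z‖ * Real.cos |z.arg| := by rw [Real.cos_abs, Complex.norm_mul_cos_arg]
  have h5 : |z.im| = ‖z‖ * Real.sin |z.arg| := by
    rw [← Complex.norm_mul_sin_arg z, abs_mul, abs_of_pos hn,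
      Real.abs_sin_eq_sin_abs_of_abs_le_pi (Complex.abs_arg_le_pi z)]
  change C * |z.im| < z.re
  rw [h4, h5]
  nlinarith

namespace IsSectorialInverse

variable {X : Type*} [NormedAddCommGroup X] [InnerProductSpace ℂ X]
  {K Q : X →L[ℂ] X} {q C ε δ : ℝ}

lemma le_norm_sub_smul (hK : IsSectorialInverse K Q q C) (hε : 0 < ε) (x : X) :
    ε * ‖x‖ ≤ ‖(K - (ε : ℂ) • 1) x‖ := by
  refine abs_le_of_sq_le_sq' ?_ (norm_nonneg _) |>.2
  have h1 : (K - (ε : ℂ) • 1) x = K x - (ε : ℂ) • x := rfl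
  rw [h1, @norm_sub_sq ℂ, inner_smul_right, ← inner_conj_symm, norm_smul, Complex.norm_real,
    Real.norm_of_nonneg hε.le]
  simp only [RCLike.re_to_complex, Complex.re_ofReal_mul, Complex.conj_re]
  nlinarith [hK.dissipative x, sq_nonneg ‖K x‖]

lemma isUnit_sub_smul [CompleteSpace X] (hK : IsSectorialInverse K Q q C) (hε : 0 < ε) :
    IsUnit (K - (ε : ℂ) • (1 : X →L[ℂ] X)) := by
  refine ContinuousLinearMap.isUnit_of_forall_le_norm_inner_map (c := ε.toNNReal) _
    (Real.toNNReal_pos.2 hε) fun x => ?_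
  have h1 : (K - (ε : ℂ) • 1) x = K x - (ε : ℂ) • x := rfl
  rw [Real.coe_toNNReal _ hε.le, h1, inner_sub_left, inner_smul_left, inner_self_eq_norm_sq_to_K,
    Complex.conj_ofReal]
  refine le_trans ?_ ((neg_le_abs _).trans (Complex.abs_re_le_norm _))
  have h2 : (inner ℂ (K x) x).re ≤ 0 := by
    rw [← inner_conj_symm, Complex.conj_re]; exact hK.dissipative x
  simp only [Complex.sub_re, Complex.re_ofReal_mul, ← Complex.ofReal_pow, Complex.coe_algebraMap,
    Complex.ofReal_re]
  linarith

lemma yosida_apply_sub [CompleteSpace X] (hK : IsSectorialInverse K Q q C) (hε : 0 < ε) (x : X) :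
    yosida K ε (K x - (ε : ℂ) • x) = x := by
  have h := Ring.inverse_mul_cancel _ (hK.isUnit_sub_smul hε)
  exact congrArg (fun T : X →L[ℂ] X => T x) h

lemma exists_eq_sub [CompleteSpace X] (hK : IsSectorialInverse K Q q C) (hε : 0 < ε) (y : X) :
    ∃ x, y = K x - (ε : ℂ) • x := by
  have h := Ring.mul_inverse_cancel _ (hK.isUnit_sub_smul hε)
  exact ⟨yosida K ε y, (congrArg (fun T : X →L[ℂ] X => T y) h).symm⟩

lemma norm_yosida_apply_le [CompleteSpace X] (hK : IsSectorialInverse K Q q C) (hε : 0 < ε) (y : X) :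
    ε * ‖yosida K ε y‖ ≤ ‖y‖ := by
  obtain ⟨x, rfl⟩ := hK.exists_eq_sub hε y
  rw [hK.yosida_apply_sub hε]
  exact hK.le_norm_sub_smul hε x

lemma yosida_apply_apply [CompleteSpace X] (hK : IsSectorialInverse K Q q C) (hε : 0 < ε) (x : X) :
    yosida K ε (K x) = x + (ε : ℂ) • yosida K ε x := by
  have h := hK.yosida_apply_sub hε x
  rwa [map_sub, map_smul, sub_eq_iff_eq_add] at h

lemma norm_yosida_apply_apply_le [CompleteSpace X] (hK : IsSectorialInverse K Q q C) (hε : 0 < ε) (x : X) :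
    ‖yosida K ε (K x)‖ ≤ 2 * ‖x‖ := by
  rw [hK.yosida_apply_apply hε]
  refine (norm_add_le _ _).trans ?_
  rw [norm_smul, Complex.norm_real, Real.norm_of_nonneg hε.le]
  linarith [hK.norm_yosida_apply_le hε x]

lemma commute_yosida (K : X →L[ℂ] X) (ε δ : ℝ) : Commute (yosida K ε) (yosida K δ) := by
  have h : Commute (K - (ε : ℂ) • (1 : X →L[ℂ] X)) (K - (δ : ℂ) • 1) :=
    ((Commute.refl K).sub_left ((Commute.one_left K).smul_left _)).sub_right
      ((Commute.one_right _).smul_right _)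
  exact h.ringInverse_ringInverse

/-- The resolvent identity `G_ε - G_δ = (ε - δ) G_ε G_δ`, evaluated on the range of `K²`. -/
lemma norm_yosida_sub_yosida_le [CompleteSpace X] (hK : IsSectorialInverse K Q q C) (hε : 0 < ε) (hδ : 0 < δ)
    (x : X) : ‖(yosida K ε - yosida K δ) (K (K x))‖ ≤ 4 * |ε - δ| * ‖x‖ := by
  have hu := Ring.inverse_mul_cancel _ (hK.isUnit_sub_smul hε)
  have hu' := Ring.mul_inverse_cancel _ (hK.isUnit_sub_smul hδ)
  have h1 : yosida K ε - yosida K δ = ((ε - δ : ℝ) : ℂ) • (yosida K ε * yosida K δ) := by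
    change yosida K ε * _ = 1 at hu
    change _ * yosida K δ = 1 at hu'
    calc yosida K ε - yosida K δ
        = yosida K ε * ((K - (δ : ℂ) • 1) * yosida K δ) -
          yosida K ε * (K - (ε : ℂ) • 1) * yosida K δ := by rw [hu, hu', mul_one, one_mul]
      _ = yosida K ε * ((K - (δ : ℂ) • 1) - (K - (ε : ℂ) • 1)) * yosida K δ := by noncomm_ring
      _ = _ := by
        rw [sub_sub_sub_cancel_left, ← sub_smul, ← Complex.ofReal_sub, mul_smul_comm, mul_one,
          smul_mul_assoc]
  have h2 : ∀ y, yosida K δ (K y) = K (yosida K δ y) := by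
    intro y
    obtain ⟨w, rfl⟩ := hK.exists_eq_sub hδ y
    rw [hK.yosida_apply_sub hδ, map_sub, map_sub, map_smul, map_smul, ← map_smul, ← map_sub,
      hK.yosida_apply_sub hδ]
  rw [h1, smul_apply, mul_apply_eq_comp, norm_smul, Complex.norm_real, Real.norm_eq_abs, h2]
  have h3 := hK.norm_yosida_apply_apply_le hε (yosida K δ (K x))
  have h4 := hK.norm_yosida_apply_apply_le hδ x
  nlinarith [abs_nonneg (ε - δ)]

/-- `z G_ε` is dissipative as soon as `z ⟪G y, y⟫` has nonpositive real part for all `y`. -/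
lemma re_inner_smul_yosida_le [CompleteSpace X] (hK : IsSectorialInverse K Q q C) {P : X →L[ℂ] X} {p : ℝ}
    (hP : IsCoerciveWeight P p) (hε : 0 < ε) {z : ℂ} (hz : 0 ≤ z.re)
    (h : ∀ x, z.re * (inner ℂ (P x) (K x)).re + z.im * (inner ℂ (P x) (K x)).im ≤ 0) (y : X) :
    (inner ℂ (P ((z • yosida K ε) y)) y).re ≤ 0 := by
  obtain ⟨x, rfl⟩ := hK.exists_eq_sub hε y
  rw [smul_apply, hK.yosida_apply_sub hε, map_smul, inner_smul_left,
    inner_sub_right, inner_smul_right]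
  have h1 := hP.le x
  have h2 := hP.im_eq_zero x
  have h3 : 0 ≤ (inner ℂ (P x) x).re := le_trans (by have := hP.pos; positivity) h1
  simp only [Complex.mul_re, Complex.conj_re, Complex.conj_im, Complex.sub_re, Complex.sub_im,
    Complex.mul_im, Complex.ofReal_re, Complex.ofReal_im, h2]
  nlinarith [h x, mul_nonneg (mul_nonneg hε.le hz) h3]

/-- The uniform bound for the approximating semigroups on the closed cone. -/
def bound (Q : X →L[ℂ] X) (q : ℝ) : ℝ := √(‖Q‖ / q)

lemma bound_nonneg : 0 ≤ bound Q q := Real.sqrt_nonneg _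

lemma norm_exp_smul_yosida_apply_le [CompleteSpace X] (hK : IsSectorialInverse K Q q C) (hε : 0 < ε) {z : ℂ}
    (hz : z ∈ closedCone C) (x : X) :
    ‖NormedSpace.exp (z • yosida K ε) x‖ ≤ bound Q q * ‖x‖ := by
  have hz' : C * |z.im| ≤ z.re := hz
  have hre : 0 ≤ z.re := le_trans (mul_nonneg hK.pos.le (abs_nonneg _)) hz'
  refine norm_exp_apply_le hK.weight _
    (hK.re_inner_smul_yosida_le hK.weight hε hre fun x => ?_) x
  have h1 := hK.sector x
  have hC := hK.pos
  set a := (inner ℂ (Q x) (K x)).re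
  set b := (inner ℂ (Q x) (K x)).im
  have h2 : z.im * b ≤ |z.im| * |b| := by rw [← abs_mul]; exact le_abs_self _
  have h3 : |z.im| * |b| ≤ |z.im| * (-(C * a)) := by gcongr
  have ha : a ≤ 0 := by
    by_contra! h
    nlinarith [abs_nonneg b, mul_pos hC h]
  nlinarith

lemma norm_exp_smul_yosida_apply_le_self [CompleteSpace X] (hK : IsSectorialInverse K Q q C) (hε : 0 < ε) {t : ℝ}
    (ht : 0 ≤ t) (x : X) : ‖NormedSpace.exp ((t : ℂ) • yosida K ε) x‖ ≤ ‖x‖ := by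
  have h := norm_exp_apply_le (X := X) isCoerciveWeight_one ((t : ℂ) • yosida K ε)
    (hK.re_inner_smul_yosida_le isCoerciveWeight_one hε (by simpa using ht) fun x => by
      simpa using mul_nonpos_of_nonneg_of_nonpos ht (hK.dissipative x)) x
  refine h.trans ?_
  have h1 : √(‖(1 : X →L[ℂ] X)‖ / 1) ≤ 1 := by
    rw [div_one, Real.sqrt_le_one]
    exact ContinuousLinearMap.norm_id_le
  exact mul_le_of_le_one_left (norm_nonneg x) h1

lemma smul_smul_yosida (s : ℝ) (z : ℂ) :
    s • (z • yosida K ε) = (s • z) • yosida K ε := by rw [smul_assoc]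

/-- A dissipative bounded injective operator has dense range. -/
lemma denseRange [CompleteSpace X] (hK : IsSectorialInverse K Q q C) : DenseRange K := by
  have hbot : (LinearMap.range K.toLinearMap)ᗮ = ⊥ := by
    rw [Submodule.eq_bot_iff]
    intro y hy
    rw [Submodule.mem_orthogonal'] at hy
    have hy' : ∀ x, inner ℂ y (K x) = 0 := fun x => hy _ ⟨x, rfl⟩
    -- the quadratic form at `y + t • z` has to stay nonpositive for small `t` of both signs
    have h1 : ∀ z, (inner ℂ z (K y)).re = 0 := by
      intro z
      have h2 : ∀ t : ℝ, t * (inner ℂ z (K y)).re + t ^ 2 * (inner ℂ z (K z)).re ≤ 0 := by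
        intro t
        have h3 := hK.dissipative (y + (t : ℂ) • z)
        rw [inner_add_left, hy', zero_add, map_add, map_smul, inner_smul_left, inner_add_right,
          inner_smul_right, Complex.conj_ofReal, Complex.re_ofReal_mul, Complex.add_re,
          Complex.re_ofReal_mul] at h3
        linarith
      set a := (inner ℂ z (K y)).re
      set b := (inner ℂ z (K z)).re
      have hb : b ≤ 0 := hK.dissipative z
      have h4 := h2 (a / (1 - b))
      have h5 : 0 < 1 - b := by linarith
      have h6 : a / (1 - b) * a + (a / (1 - b)) ^ 2 * b = a ^ 2 / (1 - b) ^ 2 := by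
        field_simp; ring
      rw [h6, div_nonpos_iff] at h4
      have : a ^ 2 = 0 := by
        rcases h4 with h | h
        · nlinarith [h.2, sq_nonneg a, pow_pos h5 2]
        · exact le_antisymm h.1 (sq_nonneg a)
      simpa using this
    have h7 := h1 (K y)
    rw [← RCLike.re_to_complex, inner_self_eq_norm_sq] at h7
    exact hK.injective (by simpa using h7)
  rw [← Submodule.topologicalClosure_eq_top_iff] at hbot
  intro y
  have hy : y ∈ (LinearMap.range K.toLinearMap).topologicalClosure := by rw [hbot]; trivial
  exact hy

lemma denseRange_sq [CompleteSpace X] (hK : IsSectorialInverse K Q q C) :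
    DenseRange fun x => K (K x) :=
  hK.denseRange.comp hK.denseRange K.continuous

/-! ### The limit of the approximating semigroups -/

/-- The `n`-th approximating semigroup `exp (z G_ε)`, with `ε = 1 / (n + 1)`. -/
def approx (K : X →L[ℂ] X) (n : ℕ) (z : ℂ) : X →L[ℂ] X :=
  NormedSpace.exp (z • yosida K (1 / (n + 1)))

variable [CompleteSpace X]

lemma norm_approx_apply_le (hK : IsSectorialInverse K Q q C) (n : ℕ) {z : ℂ}
    (hz : z ∈ closedCone C) (x : X) : ‖approx K n z x‖ ≤ bound Q q * ‖x‖ :=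
  hK.norm_exp_smul_yosida_apply_le (by positivity) hz x

lemma approx_add (K : X →L[ℂ] X) (n : ℕ) (z w : ℂ) :
    approx K n (z + w) = approx K n z * approx K n w := by
  let _ : NormedAlgebra ℚ (X →L[ℂ] X) := NormedAlgebra.restrictScalars ℚ ℂ _
  rw [approx, add_smul, NormedSpace.exp_add_of_commute (((Commute.refl _).smul_left z).smul_right w)]
  rfl

lemma differentiable_approx_apply (K : X →L[ℂ] X) (n : ℕ) (x : X) :
    Differentiable ℂ fun z => approx K n z x := fun z =>
  ((ContinuousLinearMap.apply ℂ X x).hasFDerivAt.comp_hasDerivAt z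
    (hasDerivAt_exp_smul_const (yosida K (1 / (n + 1))) z)).differentiableAt

lemma norm_approx_sub_approx_le (hK : IsSectorialInverse K Q q C) (n m : ℕ) {z : ℂ}
    (hz : z ∈ closedCone C) (x y : X) :
    ‖approx K n z x - approx K m z x‖ ≤ 2 * bound Q q * ‖x - K (K y)‖ +
      4 * bound Q q ^ 2 * ‖z‖ * ‖y‖ * (1 / (n + 1) + 1 / (m + 1)) := by
  have hB : 0 ≤ bound Q q := bound_nonneg
  have hn : (0 : ℝ) < 1 / (n + 1) := by positivity
  have hm : (0 : ℝ) < 1 / (m + 1) := by positivity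
  have h1 : ‖approx K n z (K (K y)) - approx K m z (K (K y))‖ ≤
      bound Q q ^ 2 * (‖z‖ * (4 * |(1 / (n + 1) : ℝ) - 1 / (m + 1)| * ‖y‖)) := by
    refine (norm_exp_sub_exp_apply_le
      (((commute_yosida K _ _).smul_left z).smul_right z) hB (fun s hs w => ?_)
      (fun s hs w => ?_) _).trans ?_
    · rw [smul_smul_yosida]
      exact hK.norm_exp_smul_yosida_apply_le hn (smul_mem_closedCone hz hs) w
    · rw [smul_smul_yosida]
      exact hK.norm_exp_smul_yosida_apply_le hm (smul_mem_closedCone hz hs) w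
    · rw [← smul_sub, smul_apply, norm_smul]
      gcongr
      exact hK.norm_yosida_sub_yosida_le hn hm y
  have h2 : |(1 / (n + 1) : ℝ) - 1 / (m + 1)| ≤ 1 / (n + 1) + 1 / (m + 1) := by
    rw [abs_sub_le_iff]; constructor <;> linarith
  have h3 := hK.norm_approx_apply_le n hz (x - K (K y))
  have h4 := hK.norm_approx_apply_le m hz (x - K (K y))
  rw [map_sub] at h3 h4
  have h5 : approx K n z x - approx K m z x = (approx K n z x - approx K n z (K (K y))) -
      (approx K m z x - approx K m z (K (K y))) +
      (approx K n z (K (K y)) - approx K m z (K (K y))) := by abel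
  rw [h5]
  refine (norm_add_le _ _).trans (add_le_add ((norm_sub_le _ _).trans (by linarith)) (h1.trans ?_))
  calc bound Q q ^ 2 * (‖z‖ * (4 * |(1 / (n + 1) : ℝ) - 1 / (m + 1)| * ‖y‖))
      ≤ bound Q q ^ 2 * (‖z‖ * (4 * (1 / (n + 1) + 1 / (m + 1)) * ‖y‖)) := by gcongr
    _ = _ := by ring

lemma exists_norm_sub_sq_lt (hK : IsSectorialInverse K Q q C) (x : X) {ε : ℝ} (hε : 0 < ε) :
    ∃ y, 2 * bound Q q * ‖x - K (K y)‖ < ε := by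
  have hB : 0 ≤ bound Q q := bound_nonneg
  obtain ⟨y, hy⟩ := hK.denseRange_sq.exists_dist_lt x
    (show 0 < ε / (2 * bound Q q + 1) by positivity)
  refine ⟨y, ?_⟩
  rw [dist_eq_norm, lt_div_iff₀ (by positivity)] at hy
  nlinarith [norm_nonneg (x - K (K y))]

/-- The approximating semigroups converge strongly on the closed cone. -/
lemma exists_limit (hK : IsSectorialInverse K Q q C) :
    ∃ T : ℂ → X →L[ℂ] X, ∀ z ∈ closedCone C, ∀ x,
      Tendsto (fun n => approx K n z x) atTop (𝓝 (T z x)) := by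
  have h1 : ∀ z ∈ closedCone C, ∀ x, ∃ y, Tendsto (fun n => approx K n z x) atTop (𝓝 y) := by
    intro z hz x
    refine cauchySeq_tendsto_of_complete (Metric.cauchySeq_iff'.2 fun ε hε => ?_)
    obtain ⟨y, hy⟩ := hK.exists_norm_sub_sq_lt x (half_pos hε)
    let c : ℝ := 4 * bound Q q ^ 2 * ‖z‖ * ‖y‖
    have hc : 0 ≤ c := by positivity
    have h2 : Tendsto (fun n : ℕ => c * (2 * (1 / ((n : ℝ) + 1)))) atTop (𝓝 (c * (2 * 0))) :=
      (tendsto_one_div_add_atTop_nhds_zero_nat.const_mul 2).const_mul c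
    rw [mul_zero, mul_zero] at h2
    obtain ⟨N, hN⟩ := (h2.eventually (gt_mem_nhds (half_pos hε))).exists
    refine ⟨N, fun n hn => ?_⟩
    rw [dist_eq_norm]
    refine (hK.norm_approx_sub_approx_le n N hz x y).trans_lt ?_
    have h3 : (1 / (n + 1) : ℝ) ≤ 1 / (N + 1) := by gcongr
    have h4 : c * (1 / (n + 1) + 1 / (N + 1)) ≤ c * (2 * (1 / ((N : ℝ) + 1))) := by
      gcongr; linarith
    linarith
  choose! f hf using h1
  have h2 : ∀ z ∈ closedCone C, ∃ T : X →L[ℂ] X, ∀ x,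
      Tendsto (fun n => approx K n z x) atTop (𝓝 (T x)) := fun z hz =>
    ⟨continuousLinearMapOfTendsto (fun n => approx K n z) (tendsto_pi_nhds.2 (hf z hz)), hf z hz⟩
  choose! T hT using h2
  exact ⟨T, hT⟩

section Limit

variable {T : ℂ → X →L[ℂ] X}
  (hT : ∀ z ∈ closedCone C, ∀ x, Tendsto (fun n => approx K n z x) atTop (𝓝 (T z x)))

include hT

lemma norm_limit_apply_le (hK : IsSectorialInverse K Q q C) {z : ℂ} (hz : z ∈ closedCone C)
    (x : X) : ‖T z x‖ ≤ bound Q q * ‖x‖ :=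
  le_of_tendsto (hT z hz x).norm (Eventually.of_forall fun n => hK.norm_approx_apply_le n hz x)

lemma limit_add (hK : IsSectorialInverse K Q q C) {z w : ℂ} (hz : z ∈ closedCone C)
    (hw : w ∈ closedCone C) : T (z + w) = T z * T w := by
  ext x
  refine tendsto_nhds_unique (hT _ (add_mem_closedCone hK.pos hz hw) x) ?_
  have h1 : Tendsto (fun n => approx K n z (approx K n w x - T w x)) atTop (𝓝 0) := by
    have h2 := (tendsto_iff_norm_sub_tendsto_zero.1 (hT w hw x)).const_mul (bound Q q)
    rw [mul_zero] at h2
    exact squeeze_zero_norm (fun n => hK.norm_approx_apply_le n hz _) h2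
  have h3 := h1.add (hT z hz (T w x))
  rw [zero_add] at h3
  refine h3.congr fun n => ?_
  rw [approx_add, mul_apply_eq_comp, map_sub, sub_add_cancel]

lemma norm_limit_ofReal_apply_le (hK : IsSectorialInverse K Q q C) {t : ℝ} (ht : 0 ≤ t) (x : X) :
    ‖T t x‖ ≤ ‖x‖ :=
  le_of_tendsto (hT t (ofReal_mem_closedCone ht) x).norm (Eventually.of_forall fun n =>
    hK.norm_exp_smul_yosida_apply_le_self (by positivity) ht x)

lemma norm_limit_apply_sub_le (hK : IsSectorialInverse K Q q C) {z : ℂ} (hz : z ∈ closedCone C)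
    (x : X) : ‖T z (K x) - K x‖ ≤ (bound Q q + 1) ^ 2 * (‖z‖ * (2 * ‖x‖)) := by
  have hB : 0 ≤ bound Q q := bound_nonneg
  refine le_of_tendsto ((hT z hz (K x)).sub_const (K x)).norm (Eventually.of_forall fun n => ?_)
  have hn : (0 : ℝ) < 1 / (n + 1) := by positivity
  have h1 := norm_exp_sub_exp_apply_le (L := z • yosida K (1 / (n + 1))) (L' := 0)
    (Commute.zero_right _) (M := bound Q q + 1) (by positivity) (fun s hs w => ?_)
    (fun s hs w => ?_) (K x)
  · rw [NormedSpace.exp_zero, sub_zero] at h1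
    refine h1.trans ?_
    rw [smul_apply, norm_smul]
    gcongr
    exact hK.norm_yosida_apply_apply_le hn x
  · rw [smul_smul_yosida]
    have := hK.norm_exp_smul_yosida_apply_le hn (smul_mem_closedCone hz hs) w
    nlinarith [norm_nonneg w]
  · rw [smul_zero, NormedSpace.exp_zero, one_apply_eq_self]
    nlinarith [norm_nonneg w]

lemma tendsto_limit_apply (hK : IsSectorialInverse K Q q C) (x : X) :
    Tendsto (fun z => T z x) (𝓝[closedCone C] 0) (𝓝 x) := by
  have hB : 0 ≤ bound Q q := bound_nonneg
  rw [Metric.tendsto_nhds]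
  intro ε hε
  obtain ⟨y, hy⟩ := hK.denseRange.exists_dist_lt x
    (show 0 < ε / 2 / (bound Q q + 1) by positivity)
  rw [dist_eq_norm, lt_div_iff₀ (by positivity)] at hy
  have h1 : Tendsto (fun z : ℂ => (bound Q q + 1) ^ 2 * (‖z‖ * (2 * ‖y‖))) (𝓝[closedCone C] 0)
      (𝓝 ((bound Q q + 1) ^ 2 * (‖(0 : ℂ)‖ * (2 * ‖y‖)))) :=
    ((by fun_prop : Continuous fun z : ℂ => (bound Q q + 1) ^ 2 * (‖z‖ * (2 * ‖y‖))).tendsto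
      0).mono_left nhdsWithin_le_nhds
  rw [norm_zero, zero_mul, mul_zero] at h1
  filter_upwards [h1.eventually (gt_mem_nhds (half_pos hε)), self_mem_nhdsWithin] with z h2 hz
  have h3 := norm_limit_apply_sub_le hT hK hz y
  have h4 := norm_limit_apply_le hT hK hz (x - K y)
  rw [map_sub] at h4
  rw [dist_eq_norm, show T z x - x = (T z x - T z (K y)) + (T z (K y) - K y) - (x - K y) by abel]
  have h5 := norm_sub_le (T z x - T z (K y) + (T z (K y) - K y)) (x - K y)
  have h6 := norm_add_le (T z x - T z (K y)) (T z (K y) - K y)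
  nlinarith

/-- The convergence is uniform on bounded subsets of the cone, so that the limit is holomorphic. -/
lemma differentiableOn_limit (hK : IsSectorialInverse K Q q C) :
    DifferentiableOn ℂ T {z | C * |z.im| < z.re} := by
  have hopen : IsOpen {z : ℂ | C * |z.im| < z.re} :=
    isOpen_lt (by fun_prop) Complex.continuous_re
  have hsub : {z : ℂ | C * |z.im| < z.re} ⊆ closedCone C := fun z (hz : C * |z.im| < z.re) => hz.le
  refine differentiableOn_of_apply hopen (M := bound Q q) (fun z hz =>
    ContinuousLinearMap.opNorm_le_bound _ bound_nonneg
      (norm_limit_apply_le hT hK (hsub hz))) fun x => ?_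
  refine TendstoLocallyUniformlyOn.differentiableOn (F := fun n z => approx K n z x) (φ := atTop)
    ?_ (Eventually.of_forall fun n => (differentiable_approx_apply K n x).differentiableOn) hopen
  rw [Metric.tendstoLocallyUniformlyOn_iff]
  intro ε hε z hz
  refine ⟨Metric.ball z 1 ∩ {z : ℂ | C * |z.im| < z.re}, inter_mem
    (mem_nhdsWithin_of_mem_nhds (Metric.ball_mem_nhds z one_pos)) self_mem_nhdsWithin, ?_⟩
  obtain ⟨y, hy⟩ := hK.exists_norm_sub_sq_lt x (half_pos hε)
  let c : ℝ := 4 * bound Q q ^ 2 * (‖z‖ + 1) * ‖y‖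
  have h2 : Tendsto (fun n : ℕ => c * (1 / ((n : ℝ) + 1))) atTop (𝓝 (c * 0)) :=
    tendsto_one_div_add_atTop_nhds_zero_nat.const_mul c
  rw [mul_zero] at h2
  filter_upwards [h2.eventually (gt_mem_nhds (half_pos hε))] with n hn w hw
  have hwz : ‖w‖ ≤ ‖z‖ + 1 := by
    have h3 := hw.1
    rw [mem_ball_iff_norm] at h3
    have h4 := norm_add_le (w - z) z
    rw [sub_add_cancel] at h4
    linarith
  have h5 : ‖approx K n w x - T w x‖ ≤ 2 * bound Q q * ‖x - K (K y)‖ +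
      4 * bound Q q ^ 2 * ‖w‖ * ‖y‖ * (1 / (n + 1) + 0) :=
    le_of_tendsto_of_tendsto (tendsto_const_nhds.sub (hT w (hsub hw.2) x)).norm
      ((tendsto_one_div_add_atTop_nhds_zero_nat.const_add _).const_mul _ |>.const_add _)
      (Eventually.of_forall fun m => hK.norm_approx_sub_approx_le n m (hsub hw.2) x y)
  rw [dist_comm, dist_eq_norm]
  have h6 : 4 * bound Q q ^ 2 * ‖w‖ * ‖y‖ * (1 / (n + 1) + 0) ≤ c * (1 / ((n : ℝ) + 1)) := by
    simp only [c]
    rw [add_zero]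
    gcongr
  linarith

/-- The difference quotients of `t ↦ T(t) K x` at `0` are compared with `x` through a second
approximation `x ≈ K y`. -/
lemma norm_limit_apply_sub_sub_le (hK : IsSectorialInverse K Q q C) {t : ℝ} (ht : 0 ≤ t)
    (x y : X) : ‖T t (K x) - K x - (t : ℂ) • x‖ ≤ t * (2 * ‖x - K y‖ + t * (2 * ‖y‖)) := by
  have htc := ofReal_mem_closedCone (C := C) ht
  let ε : ℕ → ℝ := fun n => 1 / ((n : ℝ) + 1)
  have hε : Tendsto (fun n => (ε n : ℂ)) atTop (𝓝 0) := by
    have h := (Complex.continuous_ofReal.tendsto 0).comp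
      tendsto_one_div_add_atTop_nhds_zero_nat
    rw [Complex.ofReal_zero] at h
    exact h
  have hcont : ∀ z : X, ∀ s : ℝ, 0 ≤ s → ∀ n, ‖approx K n s z‖ ≤ ‖z‖ := fun z s hs n =>
    hK.norm_exp_smul_yosida_apply_le_self (by positivity) hs z
  have h0 : Tendsto (fun n => approx K n t (K x - (ε n : ℂ) • x) - (K x - (ε n : ℂ) • x)
      - (t : ℂ) • x) atTop (𝓝 (T t (K x) - K x - (t : ℂ) • x)) := by
    have h1 : Tendsto (fun n => (ε n : ℂ) • x) atTop (𝓝 0) := by simpa using hε.smul_const x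
    have h2 : Tendsto (fun n => approx K n t ((ε n : ℂ) • x)) atTop (𝓝 0) :=
      squeeze_zero_norm (fun n => hcont _ t ht n) (by simpa using h1.norm)
    have h3 := ((hT t htc (K x)).sub h2).sub (tendsto_const_nhds (x := K x).sub h1)
    simp only [sub_zero] at h3
    refine (h3.sub_const ((t : ℂ) • x)).congr fun n => ?_
    rw [map_sub]
  refine le_of_tendsto h0.norm (Eventually.of_forall fun n => ?_)
  have hn : 0 < ε n := by positivity
  have hG := hK.yosida_apply_sub hn x
  have h4 := norm_exp_sub_sub_apply_le ((t : ℂ) • yosida K (ε n)) (K x - (ε n : ℂ) • x)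
    (δ := t * (2 * ‖x - K y‖ + t * (2 * ‖y‖)))
  rw [smul_apply, hG] at h4
  refine h4 fun s hs hs1 => ?_
  rw [smul_smul_yosida, map_smul, ← smul_sub, norm_smul, Complex.norm_real,
    Real.norm_of_nonneg ht]
  refine mul_le_mul_of_nonneg_left ?_ ht
  have h5 : s • (t : ℂ) = ((s * t : ℝ) : ℂ) := by simp
  rw [h5]
  have hst : 0 ≤ s * t := by positivity
  have h6 := hcont (x - K y) (s * t) hst n
  have h7 : ‖approx K n ((s * t : ℝ) : ℂ) (K y) - K y‖ ≤ t * (2 * ‖y‖) := by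
    have h8 := norm_exp_sub_exp_apply_le (L := ((s * t : ℝ) : ℂ) • yosida K (ε n)) (L' := 0)
      (Commute.zero_right _) (M := 1) zero_le_one (fun r hr w => ?_)
      (fun r hr w => by simp) (K y)
    · rw [NormedSpace.exp_zero, sub_zero, one_pow, one_mul, smul_apply, norm_smul,
        Complex.norm_real, Real.norm_of_nonneg hst] at h8
      refine h8.trans ?_
      have h9 := hK.norm_yosida_apply_apply_le hn y
      have h10 : s * t ≤ t := by nlinarith
      gcongr
    · rw [one_mul, smul_smul_yosida, show r • ((s * t : ℝ) : ℂ) = ((r * (s * t) : ℝ) : ℂ) by simp]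
      exact hcont w _ (by positivity) n
  change ‖approx K n ((s * t : ℝ) : ℂ) x - x‖ ≤ _
  rw [map_sub] at h6
  rw [show approx K n ((s * t : ℝ) : ℂ) x - x = (approx K n ((s * t : ℝ) : ℂ) x -
    approx K n ((s * t : ℝ) : ℂ) (K y)) + (approx K n ((s * t : ℝ) : ℂ) (K y) - K y) -
    (x - K y) by abel]
  have h11 := norm_sub_le (approx K n ((s * t : ℝ) : ℂ) x - approx K n ((s * t : ℝ) : ℂ) (K y) +
    (approx K n ((s * t : ℝ) : ℂ) (K y) - K y)) (x - K y)
  have h12 := norm_add_le (approx K n ((s * t : ℝ) : ℂ) x - approx K n ((s * t : ℝ) : ℂ) (K y))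
    (approx K n ((s * t : ℝ) : ℂ) (K y) - K y)
  linarith

lemma tendsto_limit_quotient (hK : IsSectorialInverse K Q q C) (x : X) :
    Tendsto (fun t : ℝ≥0 => ((t : ℝ) : ℂ)⁻¹ • (T (t : ℝ) (K x) - K x)) (𝓝[≠] 0) (𝓝 x) := by
  rw [Metric.tendsto_nhds]
  intro ε hε
  obtain ⟨y, hy⟩ := hK.denseRange.exists_dist_lt x (show 0 < ε / 4 by positivity)
  rw [dist_eq_norm] at hy
  have h1 : Tendsto (fun t : ℝ≥0 => (t : ℝ) * (2 * ‖y‖)) (𝓝[≠] 0)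
      (𝓝 (((0 : ℝ≥0) : ℝ) * (2 * ‖y‖))) :=
    ((by fun_prop : Continuous fun t : ℝ≥0 => (t : ℝ) * (2 * ‖y‖)).tendsto 0).mono_left
      nhdsWithin_le_nhds
  rw [NNReal.coe_zero, zero_mul] at h1
  filter_upwards [h1.eventually (gt_mem_nhds (half_pos hε)), self_mem_nhdsWithin] with t h2 ht
  have ht0 : (0 : ℝ) < t := NNReal.coe_pos.2 (pos_iff_ne_zero.2 ht)
  have htc : ((t : ℝ) : ℂ) ≠ 0 := Complex.ofReal_ne_zero.2 ht0.ne'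
  have h3 := norm_limit_apply_sub_sub_le hT hK ht0.le x y
  have h4 : ((t : ℝ) : ℂ)⁻¹ • (T (t : ℝ) (K x) - K x) - x =
      ((t : ℝ) : ℂ)⁻¹ • (T (t : ℝ) (K x) - K x - ((t : ℝ) : ℂ) • x) := by
    rw [smul_sub _ _ (((t : ℝ) : ℂ) • x), smul_smul, inv_mul_cancel₀ htc, one_smul]
  rw [dist_eq_norm, h4, norm_smul, norm_inv, Complex.norm_real, Real.norm_of_nonneg ht0.le,
    inv_mul_lt_iff₀ ht0]
  refine h3.trans_lt (mul_lt_mul_of_pos_left ?_ ht0)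
  linarith

end Limit

/-- The inverse of `K` generates an analytic semigroup of contractions. -/
theorem exists_semigroup (hK : IsSectorialInverse K Q q C) :
    ∃ S : C0Semigroup X, (∀ x y, (x, y) ∈ S.generatorGraph ↔ x = K y) ∧ S.IsContractive ∧
      S.IsAnalytic := by
  obtain ⟨T, hT⟩ := hK.exists_limit
  let S : C0Semigroup X :=
    { toFun := fun t => T ((t : ℝ) : ℂ)
      map_zero := by
        rw [NNReal.coe_zero, Complex.ofReal_zero]
        ext x
        refine tendsto_nhds_unique (hT 0 zero_mem_closedCone x) ?_
        simp [approx]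
      map_add := fun s t => by
        rw [NNReal.coe_add, Complex.ofReal_add]
        exact limit_add hT hK (ofReal_mem_closedCone s.2) (ofReal_mem_closedCone t.2)
      strong_continuity := fun x => by
        have h1 : Tendsto (fun t : ℝ≥0 => ((t : ℝ) : ℂ)) (𝓝 0) (𝓝[closedCone C] 0) := by
          refine tendsto_nhdsWithin_iff.2
            ⟨?_, Eventually.of_forall fun t => ofReal_mem_closedCone t.2⟩
          have h2 : Continuous fun t : ℝ≥0 => ((t : ℝ) : ℂ) := by fun_prop
          simpa using h2.tendsto 0
        exact (tendsto_limit_apply hT hK x).comp h1 }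
  have hS : ∀ t : ℝ≥0, ∀ x, ‖S.toFun t x‖ ≤ ‖x‖ := fun t x =>
    norm_limit_ofReal_apply_le hT hK t.2 x
  have hgen : ∀ y, (K y, y) ∈ S.generatorGraph := fun y => tendsto_limit_quotient hT hK y
  have hdiss : ∀ p ∈ S.generatorGraph, (inner ℂ p.1 p.2).re ≤ 0 := by
    intro p hp
    have hp' : Tendsto (fun t : ℝ≥0 => ((t : ℝ) : ℂ)⁻¹ • (S.toFun t p.1 - p.1)) (𝓝[≠] 0)
      (𝓝 p.2) := hp
    have hne : (𝓝[≠] (0 : ℝ≥0)).NeBot := inferInstance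
    refine le_of_tendsto ((Complex.continuous_re.tendsto _).comp
      (tendsto_const_nhds (x := p.1).inner (𝕜 := ℂ) hp')) (Eventually.of_forall fun t => ?_)
    have h1 : (inner ℂ p.1 (S.toFun t p.1)).re ≤ ‖p.1‖ * ‖S.toFun t p.1‖ :=
      re_inner_le_norm (𝕜 := ℂ) _ _
    have h2 : (inner ℂ p.1 p.1).re = ‖p.1‖ ^ 2 := (norm_sq_eq_re_inner (𝕜 := ℂ) p.1).symm
    have h3 := hS t p.1
    simp only [Function.comp_apply, inner_smul_right, inner_sub_right]
    rw [← Complex.ofReal_inv, Complex.re_ofReal_mul, Complex.sub_re, h2]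
    refine mul_nonpos_of_nonneg_of_nonpos (by positivity) ?_
    nlinarith [norm_nonneg p.1]
  refine ⟨S, fun x y => ⟨fun hxy => ?_, fun h => h ▸ hgen y⟩, fun t => ?_, ?_⟩
  · -- `1 - K⁻¹` is onto and `1` minus the generator is injective
    obtain ⟨w, hw⟩ := hK.exists_eq_sub one_pos (x - y)
    rw [Complex.ofReal_one, one_smul] at hw
    have h1 := S.generatorGraph.sub_mem hxy (hgen w)
    have h2 : x - K w = y - w := by
      rw [sub_eq_sub_iff_add_eq_add] at hw ⊢
      rw [hw]; abel
    have h3 := hdiss _ h1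
    simp only [Prod.fst_sub, Prod.snd_sub, h2] at h3
    have h4 : (inner ℂ (y - w) (y - w)).re = ‖y - w‖ ^ 2 :=
      (norm_sq_eq_re_inner (𝕜 := ℂ) _).symm
    rw [h4] at h3
    have h5 : y - w = 0 := by
      have := le_antisymm h3 (sq_nonneg _)
      simpa using this
    rw [h5, sub_eq_zero] at h2
    rw [h2, sub_eq_zero.1 h5]
  · exact ContinuousLinearMap.opNorm_le_bound _ zero_le_one fun x => by
      rw [one_mul]; exact hS t x
  · have hsec := sector_subset_interior_cone hK.pos
    have hsec' : C0Semigroup.sector (Real.arctan (1 / C)) ⊆ closedCone C :=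
      fun z hz => (show C * |z.im| < z.re from hsec hz).le
    refine ⟨Real.arctan (1 / C), ?_, (Real.arctan_lt_pi_div_two _).le, T, fun t => rfl,
      (differentiableOn_limit hT hK).mono hsec,
      fun z hz w hw => limit_add hT hK (hsec' hz) (hsec' hw),
      fun x => (tendsto_limit_apply hT hK x).mono_left (nhdsWithin_mono 0 hsec')⟩
    rw [← Real.arctan_zero]
    exact Real.arctan_strictMono (by have := hK.pos; positivity)

end IsSectorialInverse

namespace StrictlyPositiveOperator

variable {H : Type*} [NormedAddCommGroup H] [InnerProductSpace ℂ H] [CompleteSpace H]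

/-! ### Negative powers of the operator -/

/-- The bounded operator `A ^ (-s)`, `s ≥ 0`. -/
def invPow (A : StrictlyPositiveOperator H) (s : ℝ) : H →L[ℂ] H := A.inv ^ s

variable {A : StrictlyPositiveOperator H} {s t u : ℝ}

lemma invPow_zero : A.invPow 0 = 1 := CFC.rpow_zero _ A.inv_nonneg

lemma invPow_apply_apply (hs : 0 ≤ s) (ht : 0 ≤ t) (h : s + t = u) (x : H) :
    A.invPow s (A.invPow t x) = A.invPow u x := by
  subst h
  rcases hs.eq_or_lt with rfl | hs
  · rw [zero_add, invPow_zero]; rfl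
  rcases ht.eq_or_lt with rfl | ht
  · rw [add_zero, invPow_zero]; rfl
  have hs' : 0 < s.toNNReal := Real.toNNReal_pos.2 hs
  have ht' : 0 < t.toNNReal := Real.toNNReal_pos.2 ht
  have h := CFC.nnrpow_add (a := A.inv) hs' ht'
  rw [CFC.nnrpow_eq_rpow (add_pos hs' ht'), CFC.nnrpow_eq_rpow hs', CFC.nnrpow_eq_rpow ht',
    NNReal.coe_add, Real.coe_toNNReal _ hs.le, Real.coe_toNNReal _ ht.le] at h
  exact (congrArg (fun T : H →L[ℂ] H => T x) h).symm

lemma invPow_injective (hs : 0 ≤ s) : Function.Injective (A.invPow s) := A.inv_rpow_injective hs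

lemma inner_invPow (s : ℝ) (x y : H) : inner ℂ (A.invPow s x) y = inner ℂ x (A.invPow s y) := by
  have h : IsSelfAdjoint (A.invPow s) := IsSelfAdjoint.of_nonneg CFC.rpow_nonneg
  exact (ContinuousLinearMap.isSelfAdjoint_iff_isSymmetric.1 h) x y

lemma re_inner_invPow_nonneg (s : ℝ) (x : H) : 0 ≤ (inner ℂ x (A.invPow s x)).re := by
  have h : 0 ≤ A.invPow s := CFC.rpow_nonneg
  rw [ContinuousLinearMap.nonneg_iff_isPositive] at h
  exact h.re_inner_nonneg_right x

/-! ### Coordinates on the phase space -/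

namespace Hs

variable {r : ℝ}

lemma val_eq (hr : 0 ≤ r) (u : A.Hs r) : val u = A.invPow (r / 2) (powHalf u) :=
  ((A.mem_graph_pow_of_nonneg (by positivity) _ _).1 ((A.pow (r / 2)).mem_graph u)).symm

lemma powHalf_bijective (hr : 0 ≤ r) : Function.Bijective (powHalf : A.Hs r →ₗ[ℂ] H) := by
  refine ⟨(injective_iff_map_eq_zero _).2 powHalf_eq_zero, fun y => ?_⟩
  obtain ⟨x, -, hy⟩ := (LinearPMap.mem_graph_iff _).1
    ((A.mem_graph_pow_of_nonneg (by positivity : (0 : ℝ) ≤ r / 2) _ y).2 rfl)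
  exact ⟨x, hy⟩

/-- The map `A^{r/2} : H^r → H` as a bounded operator. -/
def powHalfL (A : StrictlyPositiveOperator H) (r : ℝ) : A.Hs r →L[ℂ] H :=
  powHalf.mkContinuous 1 fun u => by rw [one_mul, norm_eq]

/-- The map `A^{-1} : H → H^2`, inverse to `A : H^2 → H`. -/
def lift (A : StrictlyPositiveOperator H) : H →L[ℂ] A.Hs 2 :=
  (LinearEquiv.ofBijective powHalf (powHalf_bijective zero_le_two)).symm.toLinearMap.mkContinuous 1
    fun y => by
      rw [one_mul, norm_eq]
      exact (congrArg _ ((LinearEquiv.ofBijective _ _).apply_symm_apply y)).le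

lemma powHalf_lift (y : H) : powHalf (lift A y) = y :=
  (LinearEquiv.ofBijective _ (powHalf_bijective zero_le_two)).apply_symm_apply y

end Hs

namespace H1

variable {ω : ℝ} {hω : 0 < ω}

lemma val_eq (z : A.H1 ω hω) : val z = A.invPow (1 / 2) (powHalf z) :=
  Hs.val_eq zero_le_one z

lemma powHalf_bijective : Function.Bijective (powHalf : A.H1 ω hω →ₗ[ℂ] H) :=
  Hs.powHalf_bijective zero_le_one

/-- The map `A^{1/2} : H^1 → H` as a bounded operator. -/
def powHalfL (A : StrictlyPositiveOperator H) (ω : ℝ) (hω : 0 < ω) : A.H1 ω hω →L[ℂ] H :=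
  powHalf.mkContinuous (√ω)⁻¹ norm_powHalf_le

/-- The map `A^{-1/2} : H → H^1`, inverse to `A^{1/2} : H^1 → H`. -/
def lift (A : StrictlyPositiveOperator H) (ω : ℝ) (hω : 0 < ω) : H →L[ℂ] A.H1 ω hω :=
  (LinearEquiv.ofBijective powHalf powHalf_bijective).symm.toLinearMap.mkContinuous
    (√(‖A.invPow (1 / 2)‖ ^ 2 + ω)) fun y => by
      obtain ⟨z, rfl⟩ := (powHalf_bijective (A := A) (hω := hω)).2 y
      have h1 : (LinearEquiv.ofBijective powHalf powHalf_bijective).symm (powHalf z) = z :=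
        (LinearEquiv.ofBijective _ _).symm_apply_apply z
      rw [LinearEquiv.coe_coe, h1]
      refine abs_le_of_sq_le_sq' ?_ (by positivity) |>.2
      rw [mul_pow, Real.sq_sqrt (by positivity), norm_sq, val_eq, add_mul, ← mul_pow]
      gcongr
      exact ContinuousLinearMap.le_opNorm _ _

lemma powHalf_lift (y : H) : powHalf (lift A ω hω y) = y :=
  (LinearEquiv.ofBijective _ powHalf_bijective).apply_symm_apply y

/-- In terms of `A^{1/2}`, the operator `I + ω A : H^1 → H^{-1}` is multiplication by
`A^{-1} + ω`. -/
lemma pairing_eq (p z : A.H1 ω hω) :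
    pairing p z = inner ℂ (A.invPow 1 (powHalf p) + (ω : ℂ) • powHalf p) (powHalf z) := by
  rw [pairing, val_eq, val_eq, ← inner_invPow, invPow_apply_apply (by norm_num) (by norm_num)
    (by norm_num : (1 / 2 : ℝ) + 1 / 2 = 1), inner_add_left, inner_smul_left, Complex.conj_ofReal]

end H1

namespace PhaseSpace

variable {ω : ℝ} {hω : 0 < ω}

lemma inner_eq (U V : A.PhaseSpace ω hω) :
    inner ℂ U V = inner ℂ (Hs.powHalf U.u) (Hs.powHalf V.u) +
      (H1.pairing U.v V.v + inner ℂ U.θ V.θ) := by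
  rw [WithLp.prod_inner_apply, WithLp.prod_inner_apply]
  rfl

/-- The coordinate `A u`. -/
def coordU (A : StrictlyPositiveOperator H) (ω : ℝ) (hω : 0 < ω) : A.PhaseSpace ω hω →L[ℂ] H :=
  Hs.powHalfL A 2 ∘L WithLp.fstL 2 ℂ _ _

/-- The coordinate `A^{1/2} v`. -/
def coordV (A : StrictlyPositiveOperator H) (ω : ℝ) (hω : 0 < ω) : A.PhaseSpace ω hω →L[ℂ] H :=
  H1.powHalfL A ω hω ∘L WithLp.fstL 2 ℂ _ _ ∘L WithLp.sndL 2 ℂ _ _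

/-- The coordinate `θ`. -/
def coordθ (A : StrictlyPositiveOperator H) (ω : ℝ) (hω : 0 < ω) : A.PhaseSpace ω hω →L[ℂ] H :=
  WithLp.sndL 2 ℂ _ _ ∘L WithLp.sndL 2 ℂ _ _

/-- The operator into the phase space with prescribed coordinates `A u`, `A^{1/2} v`, `θ`. -/
def ofCoords (ω : ℝ) (hω : 0 < ω) {X : Type*} [NormedAddCommGroup X] [NormedSpace ℂ X]
    (A : StrictlyPositiveOperator H) (x y θ : X →L[ℂ] H) : X →L[ℂ] A.PhaseSpace ω hω :=
  (WithLp.prodContinuousLinearEquiv 2 ℂ _ _).symm.toContinuousLinearMap ∘L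
    (Hs.lift A ∘L x).prod ((WithLp.prodContinuousLinearEquiv 2 ℂ _ _).symm.toContinuousLinearMap ∘L
      (H1.lift A ω hω ∘L y).prod θ)

section

variable {X : Type*} [NormedAddCommGroup X] [NormedSpace ℂ X] (x y θ : X →L[ℂ] H) (F : X)

lemma powHalf_u_ofCoords : Hs.powHalf (ofCoords ω hω A x y θ F).u = x F := Hs.powHalf_lift _

lemma powHalf_v_ofCoords : H1.powHalf (ofCoords ω hω A x y θ F).v = y F := H1.powHalf_lift _

lemma θ_ofCoords : (ofCoords ω hω A x y θ F).θ = θ F := rfl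

end

lemma ext_coords {U V : A.PhaseSpace ω hω} (h1 : Hs.powHalf U.u = Hs.powHalf V.u)
    (h2 : H1.powHalf U.v = H1.powHalf V.v) (h3 : U.θ = V.θ) : U = V :=
  ext' ((Hs.powHalf_bijective zero_le_two).1 h1) (H1.powHalf_bijective.1 h2) h3

end PhaseSpace

/-! ### The inverse of the plate operator -/

section Inverse

variable (A) (ω : ℝ) (hω : 0 < ω) (σ : ℝ)

/-- For `F = 𝔸_ω (u, v, θ)`, the element `A^{3/2} w` with `w = -u + A^{σ-2} θ`. -/
def dataB : A.PhaseSpace ω hω →L[ℂ] H :=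
  A.invPow 1 ∘L PhaseSpace.coordV A ω hω + (ω : ℂ) • PhaseSpace.coordV A ω hω

/-- For `F = 𝔸_ω (u, v, θ)`, the element `q = A^{σ-1/2} v`. -/
def dissV : A.PhaseSpace ω hω →L[ℂ] H :=
  A.invPow (3 / 2 - σ) ∘L PhaseSpace.coordU A ω hω

/-- For `F = 𝔸_ω (u, v, θ)`, the element `r = A^{1/2} θ`. -/
def dissθ : A.PhaseSpace ω hω →L[ℂ] H :=
  -(A.invPow (1 / 2) ∘L PhaseSpace.coordθ A ω hω) - dissV A ω hω σ

/-- For `F = 𝔸_ω (u, v, θ)`, the element `p = A^{5/2-σ} u`. -/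
def dissU : A.PhaseSpace ω hω →L[ℂ] H :=
  dissθ A ω hω σ - A.invPow (σ - 1) ∘L dataB A ω hω

/-- The bounded inverse of the plate operator. -/
def plateInverse : A.PhaseSpace ω hω →L[ℂ] A.PhaseSpace ω hω :=
  PhaseSpace.ofCoords ω hω A (A.invPow (3 / 2 - σ) ∘L dissU A ω hω σ)
    (A.invPow (1 / 2) ∘L PhaseSpace.coordU A ω hω) (A.invPow (1 / 2) ∘L dissθ A ω hω σ)

end Inverse

variable {ω : ℝ} {hω : 0 < ω} {σ : ℝ} (F U : A.PhaseSpace ω hω)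

lemma pairing_eq_dataB (z : A.H1 ω hω) :
    H1.pairing F.v z = inner ℂ (dataB A ω hω F) (H1.powHalf z) := H1.pairing_eq F.v z

lemma dissV_apply : dissV A ω hω σ F = A.invPow (3 / 2 - σ) (Hs.powHalf F.u) := rfl

lemma dissθ_apply :
    dissθ A ω hω σ F = -A.invPow (1 / 2) F.θ - dissV A ω hω σ F := rfl

lemma dissU_apply :
    dissU A ω hω σ F = dissθ A ω hω σ F - A.invPow (σ - 1) (dataB A ω hω F) := rfl

lemma dataB_apply : dataB A ω hω F =
    A.invPow 1 (H1.powHalf F.v) + (ω : ℂ) • H1.powHalf F.v := rfl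

lemma powHalf_u_plateInverse : Hs.powHalf (plateInverse A ω hω σ F).u =
    A.invPow (3 / 2 - σ) (dissU A ω hω σ F) := PhaseSpace.powHalf_u_ofCoords _ _ _ _

lemma powHalf_v_plateInverse : H1.powHalf (plateInverse A ω hω σ F).v =
    A.invPow (1 / 2) (Hs.powHalf F.u) := PhaseSpace.powHalf_v_ofCoords _ _ _ _

lemma θ_plateInverse : (plateInverse A ω hω σ F).θ =
    A.invPow (1 / 2) (dissθ A ω hω σ F) := PhaseSpace.θ_ofCoords _ _ _ _

/-- The equations `𝔸_ω U = F` are solved from the bottom up: `v` is read off from the first, `θ`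
from the third and `u` from the second. -/
lemma mem_plateGraph_iff (hσ : σ ∈ Set.Icc (5 / 4 : ℝ) (3 / 2)) :
    (U, F) ∈ A.plateGraph ω hω σ ↔ U = plateInverse A ω hω σ F := by
  obtain ⟨hσ1, hσ2⟩ := hσ
  have hu : ∀ V : A.PhaseSpace ω hω, Hs.val V.u = A.invPow 1 (Hs.powHalf V.u) := fun V => by
    rw [Hs.val_eq zero_le_two]; norm_num
  constructor
  · rintro ⟨h1, ⟨a, b, h2, h3, h4⟩, ⟨d, h5, h6⟩⟩
    rw [mem_graph_pow_of_nonpos _ (by linarith)] at h2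
    rw [mem_graph_pow_of_nonneg _ (by linarith)] at h5
    rw [mem_graph_pow_of_nonneg _ (by norm_num)] at h3 h6
    change A.invPow _ _ = _ at h2 h3 h5 h6
    simp only at h1 h2 h3 h4 h5 h6
    have hb : b = dataB A ω hω F := by
      refine ext_inner_right ℂ fun y => ?_
      obtain ⟨z, rfl⟩ := (H1.powHalf_bijective (A := A) (hω := hω)).2 y
      rw [← h4, pairing_eq_dataB]
    have hv : H1.powHalf U.v = A.invPow (1 / 2) (Hs.powHalf F.u) := by
      apply A.invPow_injective (s := 1 / 2) (by norm_num)
      rw [← H1.val_eq, ← h1, hu, invPow_apply_apply (by norm_num) (by norm_num)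
        (by norm_num : (1 / 2 : ℝ) + 1 / 2 = 1)]
    have hd : d = A.invPow (1 / 2) (dissV A ω hω σ F) := by
      apply A.invPow_injective (s := σ - 1) (by linarith)
      rw [h5, ← h1, hu, dissV_apply, invPow_apply_apply (u := σ - 1 / 2) (by linarith) (by norm_num)
        (by ring), invPow_apply_apply (u := 1) (by linarith) (by linarith) (by ring)]
    have hθ : U.θ = A.invPow (1 / 2) (dissθ A ω hω σ F) := by
      rw [dissθ_apply, map_sub, map_neg, ← hd, invPow_apply_apply (by norm_num) (by norm_num)
        (by norm_num : (1 / 2 : ℝ) + 1 / 2 = 1), h6]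
      abel
    have hu' : Hs.powHalf U.u = A.invPow (3 / 2 - σ) (dissU A ω hω σ F) := by
      apply A.invPow_injective (s := 1) zero_le_one
      rw [← hu, dissU_apply, map_sub, map_sub,
        invPow_apply_apply (u := 5 / 2 - σ) zero_le_one (by linarith) (by ring),
        invPow_apply_apply (u := 5 / 2 - σ) zero_le_one (by linarith) (by ring),
        invPow_apply_apply (u := 3 / 2) (by linarith) (by linarith) (by ring), ← hb, h3, ← h2, hθ,
        invPow_apply_apply (u := 5 / 2 - σ) (by linarith) (by linarith) (by ring)]
      abel
    refine PhaseSpace.ext_coords ?_ ?_ ?_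
    · rw [hu', powHalf_u_plateInverse]
    · rw [hv, powHalf_v_plateInverse]
    · rw [hθ, θ_plateInverse]
  · rintro rfl
    have hv : H1.val (plateInverse A ω hω σ F).v = A.invPow 1 (Hs.powHalf F.u) := by
      rw [H1.val_eq, powHalf_v_plateInverse, invPow_apply_apply (by norm_num) (by norm_num)
        (by norm_num : (1 / 2 : ℝ) + 1 / 2 = 1)]
    refine ⟨?_, ⟨A.invPow (-(σ - 2)) (plateInverse A ω hω σ F).θ, dataB A ω hω F, ?_, ?_,
      pairing_eq_dataB F⟩, ⟨A.invPow (1 / 2) (dissV A ω hω σ F), ?_, ?_⟩⟩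
    · exact (hu F).trans hv.symm
    · exact (mem_graph_pow_of_nonpos _ (by linarith) _ _).2 rfl
    · refine (mem_graph_pow_of_nonneg _ (by norm_num) _ _).2 ?_
      change A.invPow (3 / 2) _ = -Hs.val (plateInverse A ω hω σ F).u + _
      rw [hu, powHalf_u_plateInverse, θ_plateInverse, dissU_apply, map_sub, map_sub,
        invPow_apply_apply (u := 5 / 2 - σ) zero_le_one (by linarith) (by ring),
        invPow_apply_apply (u := 5 / 2 - σ) zero_le_one (by linarith) (by ring),
        invPow_apply_apply (u := 3 / 2) (by linarith) (by linarith) (by ring),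
        invPow_apply_apply (u := 5 / 2 - σ) (by linarith) (by linarith) (by ring)]
      abel
    · refine (mem_graph_pow_of_nonneg _ (by linarith) _ _).2 ?_
      change A.invPow (σ - 1) _ = _
      rw [hv, dissV_apply, invPow_apply_apply (u := σ - 1 / 2) (by linarith) (by norm_num)
        (by ring), invPow_apply_apply (u := 1) (by linarith) (by linarith) (by ring)]
    · refine (mem_graph_pow_of_nonneg _ zero_le_one _ _).2 ?_
      change A.invPow 1 F.θ = -(plateInverse A ω hω σ F).θ - _
      rw [θ_plateInverse, dissθ_apply, map_sub, map_neg, invPow_apply_apply (by norm_num)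
        (by norm_num) (by norm_num : (1 / 2 : ℝ) + 1 / 2 = 1)]
      abel

lemma plateInverse_injective (hσ : σ ∈ Set.Icc (5 / 4 : ℝ) (3 / 2)) :
    Function.Injective (plateInverse A ω hω σ) := by
  refine (injective_iff_map_eq_zero _).2 fun F hF => ?_
  have h := (mem_plateGraph_iff F 0 hσ).2 hF.symm
  exact A.plateGraph_snd_eq_zero ω hω σ _ h rfl

/-- The energy identity: only the temperature is damped directly. -/
lemma inner_plateInverse (hσ : σ ∈ Set.Icc (5 / 4 : ℝ) (3 / 2)) {p q r : H}
    (hp : dissU A ω hω σ F = p) (hq : dissV A ω hω σ F = q) (hr : dissθ A ω hω σ F = r) :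
    inner ℂ F (plateInverse A ω hω σ F) =
      inner ℂ q p + (inner ℂ (r - p) q - inner ℂ (r + q) r) := by
  obtain ⟨hσ1, hσ2⟩ := hσ
  have h1 : inner ℂ (Hs.powHalf F.u) (Hs.powHalf (plateInverse A ω hω σ F).u) = inner ℂ q p := by
    rw [powHalf_u_plateInverse, ← inner_invPow, ← dissV_apply, hp, hq]
  have h2 : H1.pairing F.v (plateInverse A ω hω σ F).v = inner ℂ (r - p) q := by
    rw [pairing_eq_dataB, powHalf_v_plateInverse,
      ← invPow_apply_apply (s := σ - 1) (t := 3 / 2 - σ) (by linarith) (by linarith) (by ring),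
      ← dissV_apply, hq, ← inner_invPow, ← hp, dissU_apply, hr, sub_sub_cancel]
  have h3 : inner ℂ F.θ (plateInverse A ω hω σ F).θ = -inner ℂ (r + q) r := by
    rw [θ_plateInverse, ← inner_invPow, hr, ← inner_neg_left, ← hr, dissθ_apply, hq]
    congr 1; abel
  rw [PhaseSpace.inner_eq, h1, h2, h3]
  rfl

/-! ### The weight of the modified energy -/

/-- The operator `(u, v, θ) ↦ (0, δ A^{3-2σ} u, A^{σ-1} v)`. The hermitian form it defines, added
with a small factor to the energy, makes the damping of the temperature act on `v` (through
`⟪A^{σ-1} v, θ⟫`) and on `u` (through `⟪A^{3-2σ} u, v⟫`). -/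
def crossTerm (A : StrictlyPositiveOperator H) (ω : ℝ) (hω : 0 < ω) (σ δ : ℝ) :
    A.PhaseSpace ω hω →L[ℂ] A.PhaseSpace ω hω :=
  PhaseSpace.ofCoords ω hω A 0
    ((δ : ℂ) • A.invPow (1 / 2 - 2 * (3 / 2 - σ)) ∘L PhaseSpace.coordU A ω hω)
    (A.invPow (3 / 2 - σ) ∘L PhaseSpace.coordV A ω hω)

lemma inner_crossTerm (δ : ℝ) : inner ℂ (crossTerm A ω hω σ δ F) U =
    δ * inner ℂ (A.invPow 1 (A.invPow (1 / 2 - 2 * (3 / 2 - σ)) (Hs.powHalf F.u)) +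
      (ω : ℂ) • (A.invPow (1 / 2 - 2 * (3 / 2 - σ)) (Hs.powHalf F.u))) (H1.powHalf U.v) +
    inner ℂ (A.invPow (3 / 2 - σ) (H1.powHalf F.v)) U.θ := by
  have h2 : H1.powHalf (crossTerm A ω hω σ δ F).v =
    (δ : ℂ) • A.invPow (1 / 2 - 2 * (3 / 2 - σ)) (Hs.powHalf F.u) :=
    PhaseSpace.powHalf_v_ofCoords _ _ _ _
  have h1 : Hs.powHalf (crossTerm A ω hω σ δ F).u = 0 :=
    PhaseSpace.powHalf_u_ofCoords _ _ _ _
  have h3 : (crossTerm A ω hω σ δ F).θ = A.invPow (3 / 2 - σ) (H1.powHalf F.v) := rfl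
  rw [PhaseSpace.inner_eq, h1, inner_zero_left, zero_add, H1.pairing_eq, h2, h3, map_smul,
    smul_comm, ← smul_add, inner_smul_left, Complex.conj_ofReal]

/-- The cross terms damp `u` and `v`. -/
lemma inner_crossTerm_plateInverse (hσ : σ ∈ Set.Icc (5 / 4 : ℝ) (3 / 2)) (δ : ℝ) {p q r : H}
    (hp : dissU A ω hω σ F = p) (hq : dissV A ω hω σ F = q) (hr : dissθ A ω hω σ F = r) :
    inner ℂ F (crossTerm A ω hω σ δ (plateInverse A ω hω σ F)) =
      δ * inner ℂ (r - p) p - inner ℂ (r + q) q := by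
  obtain ⟨hσ1, hσ2⟩ := hσ
  set U := plateInverse A ω hω σ F with hU
  have h2 : H1.powHalf (crossTerm A ω hω σ δ U).v =
      (δ : ℂ) • A.invPow (σ - 1) p := by
    refine (PhaseSpace.powHalf_v_ofCoords _ _ _ _).trans ?_
    change (δ : ℂ) • A.invPow _ (Hs.powHalf U.u) = _
    rw [powHalf_u_plateInverse, hp, invPow_apply_apply (u := σ - 1) (by linarith) (by linarith) (by ring)]
  have h1 : Hs.powHalf (crossTerm A ω hω σ δ U).u = 0 :=
    PhaseSpace.powHalf_u_ofCoords _ _ _ _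
  have h3 : (crossTerm A ω hω σ δ U).θ = A.invPow (1 / 2) q := by
    change A.invPow (3 / 2 - σ) (H1.powHalf U.v) = _
    rw [powHalf_v_plateInverse, ← hq, dissV_apply,
      invPow_apply_apply (u := 2 - σ) (by linarith) (by linarith) (by ring),
      invPow_apply_apply (u := 2 - σ) (by linarith) (by linarith) (by ring)]
  rw [PhaseSpace.inner_eq, h1, inner_zero_right, zero_add, pairing_eq_dataB, h2, h3,
    inner_smul_right, ← inner_invPow, ← inner_invPow, ← neg_neg (A.invPow (1 / 2) F.θ),
    inner_neg_left, ← sub_eq_add_neg]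
  congr 3
  · rw [← hp, dissU_apply, hr, sub_sub_cancel]
  · rw [← hr, dissθ_apply, hq, sub_add_cancel]

/-- The remaining terms produced by the cross terms are controlled by the damping. -/
lemma exists_norm_inner_crossTerm_le (A : StrictlyPositiveOperator H) (ω : ℝ) (hω : 0 < ω)
    (hσ : σ ∈ Set.Icc (5 / 4 : ℝ) (3 / 2)) :
    ∃ c : ℝ, 1 ≤ c ∧ ∀ (δ : ℝ) (F : A.PhaseSpace ω hω) (p q r : H), 0 ≤ δ →
      dissU A ω hω σ F = p → dissV A ω hω σ F = q → dissθ A ω hω σ F = r →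
      ‖inner ℂ (crossTerm A ω hω σ δ F) (plateInverse A ω hω σ F)‖ ≤
        δ * (c * ‖q‖ ^ 2) + c * (‖r‖ + ‖p‖) * ‖r‖ := by
  obtain ⟨hσ1, hσ2⟩ := hσ
  let α := 3 / 2 - σ
  let c₁ := ‖A.invPow (2 - 4 * α)‖ + ω * ‖A.invPow (1 - 4 * α)‖
  let c₂ := ‖A.invPow (2 * α)‖ / ω
  have hα : α = 3 / 2 - σ := rfl
  refine ⟨1 + c₁ + c₂, by have : 0 ≤ c₁ + c₂ := (by positivity); linarith, ?_⟩
  intro δ F p q r hδ hp hq hr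
  have hc₁ : 0 ≤ c₁ := by positivity
  have hc₂ : 0 ≤ c₂ := by positivity
  -- the first term is `⟪A^{4α-2} q, q⟫ + ω ⟪A^{4α-1} q, q⟫`, where `4α ≤ 1`
  have h1 : ‖inner ℂ (A.invPow 1 (A.invPow (1 / 2 - 2 * α) (Hs.powHalf F.u)) +
      (ω : ℂ) • (A.invPow (1 / 2 - 2 * α) (Hs.powHalf F.u)))
      (H1.powHalf (plateInverse A ω hω σ F).v)‖ ≤ c₁ * ‖q‖ ^ 2 := by
    have e1 : inner ℂ (A.invPow (1 / 2 - 2 * α) (Hs.powHalf F.u))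
        (A.invPow (1 / 2) (Hs.powHalf F.u)) = inner ℂ (A.invPow (1 - 4 * α) q) q := by
      rw [← inner_invPow, ← hq, dissV_apply, ← hα, ← inner_invPow,
        invPow_apply_apply (u := 1 - 2 * α) (by norm_num) (by linarith) (by ring),
        invPow_apply_apply (u := 1 - 3 * α) (by linarith) (by linarith) (by ring),
        invPow_apply_apply (u := 1 - 2 * α) (by linarith) (by linarith) (by ring)]
    have e2 : inner ℂ (A.invPow 1 (A.invPow (1 / 2 - 2 * α) (Hs.powHalf F.u)))
        (A.invPow (1 / 2) (Hs.powHalf F.u)) = inner ℂ (A.invPow (2 - 4 * α) q) q := by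
      rw [← inner_invPow, ← hq, dissV_apply, ← hα, ← inner_invPow,
        invPow_apply_apply (u := 3 / 2) (by norm_num) (by norm_num) (by norm_num),
        invPow_apply_apply (u := 2 - 2 * α) (by norm_num) (by linarith) (by ring),
        invPow_apply_apply (u := 2 - 3 * α) (by linarith) (by linarith) (by ring),
        invPow_apply_apply (u := 2 - 2 * α) (by linarith) (by linarith) (by ring)]
    have e3 : ∀ T : H →L[ℂ] H, ‖inner ℂ (T q) q‖ ≤ ‖T‖ * ‖q‖ ^ 2 := fun T =>
      (norm_inner_le_norm _ _).trans (by nlinarith [T.le_opNorm q, norm_nonneg q])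
    rw [powHalf_v_plateInverse, inner_add_left, inner_smul_left, Complex.conj_ofReal, e1, e2]
    refine (norm_add_le _ _).trans ?_
    rw [norm_mul, Complex.norm_real, Real.norm_of_nonneg hω.le]
    nlinarith [e3 (A.invPow (2 - 4 * α)), e3 (A.invPow (1 - 4 * α))]
  -- for the second term, `(A⁻¹ + ω) A^{1-σ} g = r - p` where `g = A^{1/2} F.v`
  have h2 : ‖inner ℂ (A.invPow α (H1.powHalf F.v)) (plateInverse A ω hω σ F).θ‖ ≤
      c₂ * (‖r‖ + ‖p‖) * ‖r‖ := by
    set g := H1.powHalf F.v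
    set x := A.invPow (σ - 1) g with hx
    have e1 : r - p = A.invPow 1 x + (ω : ℂ) • x := by
      rw [← hp, dissU_apply, hr, sub_sub_cancel, dataB_apply, map_add, map_smul, hx,
        invPow_apply_apply (u := σ) (by linarith) (by norm_num) (by ring),
        invPow_apply_apply (u := σ) (by norm_num) (by linarith) (by ring)]
    have e2 : ω * ‖x‖ ≤ ‖r‖ + ‖p‖ := by
      refine le_trans ?_ (norm_sub_le r p)
      rcases eq_or_lt_of_le (norm_nonneg x) with h0 | h0
      · rw [← h0, mul_zero]; exact norm_nonneg _
      have e3 : (inner ℂ x (r - p)).re ≤ ‖x‖ * ‖r - p‖ := re_inner_le_norm (𝕜 := ℂ) _ _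
      have e4 : (inner ℂ x x).re = ‖x‖ ^ 2 := (norm_sq_eq_re_inner (𝕜 := ℂ) x).symm
      have e5 := A.re_inner_invPow_nonneg 1 x
      have e6 : (inner ℂ x (r - p)).re = (inner ℂ x (A.invPow 1 x)).re + ω * ‖x‖ ^ 2 := by
        rw [e1, inner_add_right, inner_smul_right, Complex.add_re, Complex.re_ofReal_mul, e4]
      have e7 : ‖x‖ * (ω * ‖x‖) ≤ ‖x‖ * ‖r - p‖ := by nlinarith
      exact le_of_mul_le_mul_left e7 h0
    have e3 : inner ℂ (A.invPow α g) (plateInverse A ω hω σ F).θ =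
        inner ℂ (A.invPow (2 * α) x) r := by
      rw [θ_plateInverse, hr, ← inner_invPow, hx,
        invPow_apply_apply (u := 1 / 2 + α) (by norm_num) (by linarith) (by ring),
        invPow_apply_apply (u := 1 / 2 + α) (by linarith) (by linarith) (by rw [hα]; ring)]
    rw [e3]
    refine (norm_inner_le_norm _ _).trans (mul_le_mul_of_nonneg_right ?_ (norm_nonneg r))
    refine ((A.invPow (2 * α)).le_opNorm x).trans ?_
    have e4 : ‖x‖ ≤ (‖r‖ + ‖p‖) / ω := by rw [le_div_iff₀ hω]; linarith
    calc ‖A.invPow (2 * α)‖ * ‖x‖ ≤ ‖A.invPow (2 * α)‖ * ((‖r‖ + ‖p‖) / ω) := by gcongr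
      _ = c₂ * (‖r‖ + ‖p‖) := by simp only [c₂]; ring
  rw [inner_crossTerm]
  refine (norm_add_le _ _).trans (add_le_add ?_ (h2.trans ?_))
  · rw [norm_mul, Complex.norm_real, Real.norm_of_nonneg hδ]
    refine mul_le_mul_of_nonneg_left (h1.trans ?_) hδ
    gcongr
    linarith
  · gcongr
    linarith

end StrictlyPositiveOperator

/-! ### Sectoriality of the plate operator -/

lemma isCoerciveWeight_one_add_smul {X : Type*} [NormedAddCommGroup X] [InnerProductSpace ℂ X]
    [CompleteSpace X] (P : X →L[ℂ] X) {κ : ℝ} (hκ : 0 ≤ κ) (hP : κ * ‖P‖ ≤ 1 / 4) :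
    IsCoerciveWeight (1 + (κ : ℂ) • (P + P.adjoint)) (1 / 2) := by
  have h1 : ∀ x y : X, inner ℂ ((1 + (κ : ℂ) • (P + P.adjoint)) x) y =
      inner ℂ x y + κ * (inner ℂ (P x) y + inner ℂ x (P y)) := by
    intro x y
    change inner ℂ (x + (κ : ℂ) • (P x + P.adjoint x)) y = _
    rw [inner_add_left, inner_smul_left, inner_add_left, ContinuousLinearMap.adjoint_inner_left,
      Complex.conj_ofReal]
  refine ⟨fun x y => ?_, by norm_num, fun x => ?_⟩
  · rw [h1]
    change _ = inner ℂ x (y + (κ : ℂ) • (P y + P.adjoint y))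
    rw [inner_add_right, inner_smul_right, inner_add_right,
      ContinuousLinearMap.adjoint_inner_right]
    ring
  · rw [h1, Complex.add_re, Complex.re_ofReal_mul, Complex.add_re]
    have h2 : (inner ℂ x x).re = ‖x‖ ^ 2 := (norm_sq_eq_re_inner (𝕜 := ℂ) x).symm
    have h3 : ‖inner ℂ (P x) x‖ ≤ ‖P‖ * ‖x‖ ^ 2 :=
      (norm_inner_le_norm _ _).trans (by nlinarith [P.le_opNorm x, norm_nonneg x])
    have h4 : ‖inner ℂ x (P x)‖ ≤ ‖P‖ * ‖x‖ ^ 2 :=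
      (norm_inner_le_norm _ _).trans (by nlinarith [P.le_opNorm x, norm_nonneg x])
    have h5 := neg_le_of_abs_le ((Complex.abs_re_le_norm _).trans h3)
    have h6 := neg_le_of_abs_le ((Complex.abs_re_le_norm _).trans h4)
    have h7 := mul_le_mul_of_nonneg_right hP (sq_nonneg ‖x‖)
    rw [h2]
    nlinarith

/-- The combination of the energy identity with the cross terms, in terms of the norms `a`, `b`, `d`
of the damped quantities. -/
lemma abs_im_le_of_damping {c δ κ a b d : ℝ} {w₀ w₁ w₂ : ℂ} (hc : 0 < c) (hδ : 0 < δ)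
    (hδ2 : δ ≤ 1 / 2) (hκ : 0 < κ) (hκ2 : κ ≤ 1 / 2)
    (hκD : κ * (c + 1 + (c + δ) ^ 2 / (2 * δ)) ≤ 1 / 2)
    (hre : w₀.re = -d ^ 2)
    (hnorm0 : ‖w₀‖ ≤ b * a + ((d + a) * b + (d + b) * d))
    (hcross : ‖w₁‖ ≤ b ^ 2 / 2 + c * (d + a) * d)
    (hre2 : w₂.re ≤ δ * (d * a - a ^ 2) + (d * b - b ^ 2))
    (hnorm2 : ‖w₂‖ ≤ δ * ((d + a) * a) + (d + b) * b) :
    |(w₀ + κ * (w₁ + w₂)).im| ≤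
      -((5 + κ * (1 / 2 + 2 * c + 2 * δ + 2)) / (κ * δ / 4) * (w₀ + κ * (w₁ + w₂)).re) := by
  set N := 5 + κ * (1 / 2 + 2 * c + 2 * δ + 2) with hN
  set m := κ * δ / 4 with hmdef
  have hm : 0 < m := by positivity
  have hN0 : 0 < N := by positivity
  have hre1 : w₁.re ≤ b ^ 2 / 2 + c * (d + a) * d := (Complex.re_le_norm w₁).trans hcross
  have hmix : (c + δ) * a * d ≤ δ * a ^ 2 / 2 + (c + δ) ^ 2 / (2 * δ) * d ^ 2 := by
    have e : δ * a ^ 2 / 2 + (c + δ) ^ 2 / (2 * δ) * d ^ 2 - (c + δ) * a * d =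
        (δ * a - (c + δ) * d) ^ 2 / (2 * δ) := by field_simp; ring
    have : 0 ≤ (δ * a - (c + δ) * d) ^ 2 / (2 * δ) := by positivity
    linarith
  have hreW : (w₀ + κ * (w₁ + w₂)).re ≤ -(m * (a ^ 2 + b ^ 2 + d ^ 2)) := by
    rw [Complex.add_re, Complex.re_ofReal_mul, Complex.add_re, hre]
    have e1 : w₁.re + w₂.re ≤ -(b ^ 2 / 4) - δ * a ^ 2 / 2 + (c + 1 + (c + δ) ^ 2 / (2 * δ)) * d ^ 2 := by
      have : d * b ≤ b ^ 2 / 4 + d ^ 2 := by nlinarith [sq_nonneg (b / 2 - d)]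
      linarith
    have e2 := mul_le_mul_of_nonneg_left e1 hκ.le
    have e3 : κ * (c + 1 + (c + δ) ^ 2 / (2 * δ)) * d ^ 2 ≤ 1 / 2 * d ^ 2 := by gcongr
    have e4 : m ≤ κ / 4 := by rw [hmdef]; nlinarith
    have e5 : m ≤ 1 / 2 := by linarith
    have e6 := mul_le_mul_of_nonneg_right e4 (sq_nonneg b)
    have e7 := mul_le_mul_of_nonneg_right e5 (sq_nonneg d)
    have e8 : m * a ^ 2 ≤ κ * (δ * a ^ 2 / 2) := by
      have : 0 ≤ κ * δ * a ^ 2 := by positivity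
      rw [hmdef]; linarith
    linarith
  have hnormW : ‖w₀ + κ * (w₁ + w₂)‖ ≤ N * (a ^ 2 + b ^ 2 + d ^ 2) := by
    have hab : 2 * (a * b) ≤ a ^ 2 + b ^ 2 := by linarith [two_mul_le_add_sq a b]
    have had : 2 * (a * d) ≤ a ^ 2 + d ^ 2 := by linarith [two_mul_le_add_sq a d]
    have hbd : 2 * (b * d) ≤ b ^ 2 + d ^ 2 := by linarith [two_mul_le_add_sq b d]
    have hsa := sq_nonneg a
    have hsb := sq_nonneg b
    have hsd := sq_nonneg d
    set s := a ^ 2 + b ^ 2 + d ^ 2 with hs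
    have e0 : ‖w₀‖ ≤ 5 * s := by linarith
    have e1 : ‖w₁‖ ≤ (1 / 2 + 2 * c) * s := by
      have : c * ((d + a) * d) ≤ c * (2 * s) := 
        mul_le_mul_of_nonneg_left (by linarith) (by positivity)
      linarith
    have e2 : ‖w₂‖ ≤ (2 * δ + 2) * s := by
      have : δ * ((d + a) * a) ≤ δ * (2 * s) := 
        mul_le_mul_of_nonneg_left (by linarith) (by positivity)
      linarith
    refine (norm_add_le _ _).trans ?_
    rw [norm_mul, Complex.norm_real, Real.norm_of_nonneg hκ.le]
    have e3 := mul_le_mul_of_nonneg_left ((norm_add_le w₁ w₂).trans (add_le_add e1 e2)) hκ.le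
    rw [hN]
    linarith
  refine (Complex.abs_im_le_norm _).trans (hnormW.trans ?_)
  have h1 : N / m * (m * (a ^ 2 + b ^ 2 + d ^ 2)) ≤ N / m * -(w₀ + κ * (w₁ + w₂)).re :=
    mul_le_mul_of_nonneg_left (by linarith) (by positivity)
  rw [← mul_assoc, div_mul_cancel₀ _ hm.ne'] at h1
  linarith

namespace StrictlyPositiveOperator

variable {H : Type*} [NormedAddCommGroup H] [InnerProductSpace ℂ H] [CompleteSpace H]
  {A : StrictlyPositiveOperator H} {ω : ℝ} {hω : 0 < ω} {σ : ℝ}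

lemma re_inner_plateInverse (hσ : σ ∈ Set.Icc (5 / 4 : ℝ) (3 / 2)) (F : A.PhaseSpace ω hω) :
    (inner ℂ F (plateInverse A ω hω σ F)).re = -‖dissθ A ω hω σ F‖ ^ 2 := by
  have hsymm : ∀ x y : H, (inner ℂ x y).re = (inner ℂ y x).re := fun x y => by
    rw [← inner_conj_symm, Complex.conj_re]
  have h1 : ∀ x : H, (inner ℂ x x).re = ‖x‖ ^ 2 := fun x => (norm_sq_eq_re_inner (𝕜 := ℂ) x).symm
  rw [inner_plateInverse F hσ rfl rfl rfl]
  simp only [inner_sub_left, inner_add_left, Complex.add_re, Complex.sub_re, h1]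
  rw [hsymm (dissV A ω hω σ F) (dissU A ω hω σ F), hsymm (dissV A ω hω σ F) (dissθ A ω hω σ F)]
  ring

/-- In the modified energy every one of `p = A^{5/2-σ} u`, `q = A^{σ-1/2} v`, `r = A^{1/2} θ` is
damped, and the whole form is bounded by these same quantities. -/
lemma exists_isSectorialInverse (A : StrictlyPositiveOperator H) (ω : ℝ) (hω : 0 < ω)
    (hσ : σ ∈ Set.Icc (5 / 4 : ℝ) (3 / 2)) :
    ∃ (Q : A.PhaseSpace ω hω →L[ℂ] A.PhaseSpace ω hω) (q C : ℝ),
      IsSectorialInverse (plateInverse A ω hω σ) Q q C := by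
  obtain ⟨c, hc, hcross⟩ := exists_norm_inner_crossTerm_le A ω hω hσ
  -- `δ` is chosen so that the error `δ c ‖q‖²` takes up half of the damping of `q`
  obtain ⟨δ, hδ, hδc, hδ2⟩ : ∃ δ : ℝ, 0 < δ ∧ δ * c = 1 / 2 ∧ δ ≤ 1 / 2 := by
    refine ⟨1 / (2 * c), by positivity, by field_simp, ?_⟩
    rw [div_le_div_iff₀ (by positivity) two_pos]
    linarith
  let P := crossTerm A ω hω σ δ
  obtain ⟨D, hDdef⟩ : ∃ D, D = c + 1 + (c + δ) ^ 2 / (2 * δ) := ⟨_, rfl⟩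
  have hD : 1 ≤ D := by
    have : 0 ≤ c + (c + δ) ^ 2 / (2 * δ) := by positivity
    linarith
  -- `κ` makes the weight coercive and keeps half of the damping of `r`
  obtain ⟨κ, hκ, hκD, hκP⟩ : ∃ κ : ℝ, 0 < κ ∧ κ * D ≤ 1 / 2 ∧ κ * ‖P‖ ≤ 1 / 4 := by
    have hP := norm_nonneg P
    refine ⟨1 / (2 * D + 4 * ‖P‖), by positivity, ?_, ?_⟩ <;>
      rw [one_div, inv_mul_le_iff₀ (by positivity)] <;> linarith
  have hκ2 : κ ≤ 1 / 2 := by nlinarith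
  rw [hDdef] at hκD
  refine ⟨1 + (κ : ℂ) • (P + P.adjoint), 1 / 2,
    (5 + κ * (1 / 2 + 2 * c + 2 * δ + 2)) / (κ * δ / 4), plateInverse_injective hσ, fun F => ?_,
    isCoerciveWeight_one_add_smul P hκ.le hκP, by positivity, fun F => ?_⟩
  · rw [re_inner_plateInverse hσ]
    exact neg_nonpos.2 (sq_nonneg _)
  obtain ⟨p, hp⟩ : ∃ p, dissU A ω hω σ F = p := ⟨_, rfl⟩
  obtain ⟨q, hq⟩ : ∃ q, dissV A ω hω σ F = q := ⟨_, rfl⟩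
  obtain ⟨r, hr⟩ : ∃ r, dissθ A ω hω σ F = r := ⟨_, rfl⟩
  have hcross := hcross δ F p q r hδ.le hp hq hr
  have hre := re_inner_plateInverse hσ F
  have hW : inner ℂ ((1 + (κ : ℂ) • (P + P.adjoint)) F) (plateInverse A ω hω σ F) =
      inner ℂ F (plateInverse A ω hω σ F) + κ * (inner ℂ (P F) (plateInverse A ω hω σ F) +
        inner ℂ F (P (plateInverse A ω hω σ F))) := by
    change inner ℂ (F + (κ : ℂ) • (P F + P.adjoint F)) _ = _
    rw [inner_add_left, inner_smul_left, inner_add_left, ContinuousLinearMap.adjoint_inner_left,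
      Complex.conj_ofReal]
  have hw2 : inner ℂ F (P (plateInverse A ω hω σ F)) =
    δ * inner ℂ (r - p) p - inner ℂ (r + q) q := inner_crossTerm_plateInverse F hσ δ hp hq hr
  rw [hW, hw2]
  have hw0 := inner_plateInverse F hσ hp hq hr
  rw [hr] at hre
  set w₀ := inner ℂ F (plateInverse A ω hω σ F)
  change ‖inner ℂ (P F) (plateInverse A ω hω σ F)‖ ≤ _ at hcross
  set w₁ := inner ℂ (P F) (plateInverse A ω hω σ F)
  obtain ⟨a, ha⟩ : ∃ a, ‖p‖ = a := ⟨_, rfl⟩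
  obtain ⟨b, hb⟩ : ∃ b, ‖q‖ = b := ⟨_, rfl⟩
  obtain ⟨d, hd⟩ : ∃ d, ‖r‖ = d := ⟨_, rfl⟩
  have hsub : ∀ x : H, ‖inner ℂ (r - p) x‖ ≤ (d + a) * ‖x‖ := fun x =>
    (norm_inner_le_norm _ _).trans
      (mul_le_mul_of_nonneg_right (by rw [← ha, ← hd]; exact norm_sub_le r p) (norm_nonneg x))
  have hadd : ∀ x : H, ‖inner ℂ (r + q) x‖ ≤ (d + b) * ‖x‖ := fun x =>
    (norm_inner_le_norm _ _).trans
      (mul_le_mul_of_nonneg_right (by rw [← hb, ← hd]; exact norm_add_le r q) (norm_nonneg x))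
  rw [ha, hb, hd] at hcross
  rw [hd] at hre
  have hnorm0 : ‖w₀‖ ≤ b * a + ((d + a) * b + (d + b) * d) := by
    rw [hw0]
    refine (norm_add_le _ _).trans (add_le_add ?_ ((norm_sub_le _ _).trans (add_le_add ?_ ?_)))
    · rw [← ha, ← hb]; exact norm_inner_le_norm q p
    · rw [← hb]; exact hsub q
    · rw [← hd]; exact hd ▸ hadd r
  have hnorm2 : ‖δ * inner ℂ (r - p) p - inner ℂ (r + q) q‖ ≤ δ * ((d + a) * a) + (d + b) * b := by
    refine (norm_sub_le _ _).trans (add_le_add ?_ ?_)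
    · rw [norm_mul, Complex.norm_real, Real.norm_of_nonneg hδ.le]
      refine mul_le_mul_of_nonneg_left ?_ hδ.le
      have := hsub p
      rwa [ha] at this
    · have := hadd q
      rwa [hb] at this
  have hself : ∀ x : H, (inner ℂ x x).re = ‖x‖ ^ 2 := fun x =>
    (norm_sq_eq_re_inner (𝕜 := ℂ) x).symm
  have hre2 : ((δ : ℂ) * inner ℂ (r - p) p - inner ℂ (r + q) q).re ≤
      δ * (d * a - a ^ 2) + (d * b - b ^ 2) := by
    have e1 : (inner ℂ r p).re ≤ ‖r‖ * ‖p‖ := re_inner_le_norm (𝕜 := ℂ) _ _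
    have e2 := neg_le_of_abs_le ((Complex.abs_re_le_norm _).trans (norm_inner_le_norm (𝕜 := ℂ) r q))
    rw [Complex.sub_re, Complex.re_ofReal_mul, inner_sub_left, inner_add_left, Complex.sub_re,
      Complex.add_re, hself, hself]
    rw [ha, hd] at e1
    rw [hd, hb] at e2
    rw [ha, hb]
    have := mul_le_mul_of_nonneg_left e1 hδ.le
    linarith
  have hδb : δ * (c * b ^ 2) = b ^ 2 / 2 := by rw [← mul_assoc, hδc]; ring
  rw [hδb] at hcross
  exact abs_im_le_of_damping (by linarith) hδ hδ2 hκ hκ2 hκD hre hnorm0 hcross hre2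
    hnorm2

end StrictlyPositiveOperator

end
theorem theorem12 {H : Type*} [NormedAddCommGroup H] [InnerProductSpace ℂ H] [CompleteSpace H]
    (A : StrictlyPositiveOperator H) (ω : ℝ) (hω : 0 < ω) (σ : ℝ)
    (hσ : σ ∈ Set.Icc (5 / 4 : ℝ) (3 / 2)) :
    ∃ S : C0Semigroup (A.PhaseSpace ω hω),
      S.generator = A.plateOperator ω hω σ ∧ S.IsContractive ∧ S.IsAnalytic := by
  obtain ⟨Q, q, C, hK⟩ := StrictlyPositiveOperator.exists_isSectorialInverse A ω hω hσ
  obtain ⟨S, hgen, hcontr, han⟩ := hK.exists_semigroup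
  refine ⟨S, LinearPMap.eq_of_eq_graph ?_, hcontr, han⟩
  rw [S.generator_graph, A.plateOperator_graph]
  ext ⟨U, F⟩
  rw [hgen, StrictlyPositiveOperator.mem_plateGraph_iff F U hσ]
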